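/- **Setting.** Let $n=\sum_{i=1}^N n_i$, write $\boldsymbol x=(x_1,\dots,x_N)\in\mathbb R^{n}=\mathbb R^{n_1}\times\dots\times\mathbb R^{n_N}$ with the Euclidean norm, and for $z\in\mathbb R^{n_i}$ let $\boldsymbol x+U_i(z-x_i)$ be $\boldsymbol x$ with its $i$-th block replaced by $z$. Let $f,h:\mathbb R^n\to\mathbb R\cup\{\infty\}$ and $g_i:\mathbb R^{n_i}\to\mathbb R\cup\{\infty\}$ be proper and lower semicontinuous, and put $\varphi(\boldsymbol x)=f(\boldsymbol x)+\sum_{i=1}^N g_i(x_i)$. For $\boldsymbol x\in\operatorname{dom}h$ let $h^i_{\boldsymbol x}(z)=h(\boldsymbol x+U_i(z-x_i))$. Assume: * $\operatorname{int}\operatorname{dom}h\ne\emptyset$, $h$ is $C^1$ on $\operatorname{int}\operatorname{dom}h$, and for all $\boldsymbol x\in\operatorname{dom}h$ and all $i$ the function $h^i_{\boldsymbol x}$ is strictly convex and $1$-coercive ($h^i_{\boldsymbol x}(z)/\|z\|\to\infty$ as $\|z\|\to\infty$); $h$ is essentially smooth: $\|\nabla h(\boldsymbol u^k)\|\to\infty$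 whenever $\boldsymbol u^k\in\operatorname{int}\operatorname{dom}h$ converges to a boundary point of $\operatorname{dom}h$; * $f$ is $C^1$ on $\operatorname{int}\operatorname{dom}h$ and $(L_1,\dots,L_N)$-smooth relative to $h$: $\operatorname{dom}h\subseteq\operatorname{dom}f$, $L_i\ge0$, and for all $\boldsymbol x\in\operatorname{dom}h$ and all $i$ the function $z\mapsto L_i h(\boldsymbol x+U_i(z-x_i))-f(\boldsymbol x+U_i(z-x_i))$ is convex on $\operatorname{dom}h^i_{\boldsymbol x}$; * $\operatorname{argmin}\varphi\neq\emptyset$ and $\operatorname{dom}\varphi\subseteq\operatorname{int}\operatorname{dom}h$; * $h$ is multi-block globally strongly convex with moduli $\sigma_1,\dots,\sigma_N>0$: every $h^i_{\boldsymbol x}$, $\boldsymbol x\in\operatorname{dom}h$, is $\sigma_i$-strongly convex; * $\nabla f$ and $\nabla h$ are locally Lipschitz continuous on $\operatorname{int}\operatorname{dom}h$. For $\boldsymbol x\in\operatorname{int}\operatorname{dom}h$ let $D_h(\boldsymbol y,\boldsymbol x)=h(\boldsymbol y)-h(\boldsymbol x)-\langle\nabla h(\boldsymbol x),\boldsymbol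 y-\boldsymbol x\rangle$. Let $\gamma_i\in(0,1/L_i)$ (any $\gamma_i>0$ if $L_i=0$). A sequence $(\boldsymbol x^k)_{k\ge0}$ is generated by BPALM if for all $k\ge 0$ and $i=1,\dots,N$, with $\boldsymbol x^{k,i-1}=(x_1^{k+1},\dots,x_{i-1}^{k+1},x_i^k,\dots,x_N^k)$, one has $\boldsymbol x^{k,i-1}\in\operatorname{int}\operatorname{dom}h$ and $$x_i^{k+1}\in\operatorname*{argmin}_{z\in\mathbb R^{n_i}}\Big\{\langle\nabla_i f(\boldsymbol x^{k,i-1}),z-x_i^k\rangle+\tfrac1{\gamma_i}D_h\big(\boldsymbol x^{k,i-1}+U_i(z-x_i^k),\boldsymbol x^{k,i-1}\big)+g_i(z)\Big\},$$ where the minimum is finite. Let $\partial\varphi$ be the limiting subdifferential of $\varphi$. We say that $\varphi$ satisfies the KL inequality of Łojasiewicz type at $\boldsymbol x^\star$ with exponent $\theta$ if there are $\kappa,\varepsilon,\eta>0$ such that $$(\varphi(\boldsymbol x)-\varphi(\boldsymbol x^\star))^\theta\le\kappa\,\operatorname{dist}(0,\partial\varphi(\boldsymbol x))$$ for all $\boldsymbol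 x$ with $\|\boldsymbol x-\boldsymbol x^\star\|<\varepsilon$ and $\varphi(\boldsymbol x^\star)<\varphi(\boldsymbol x)<\varphi(\boldsymbol x^\star)+\eta$ (with $\operatorname{dist}(0,\emptyset)=\infty$). **Theorem (convergence rate).** Suppose that a sequence $(\boldsymbol x^k)$ generated by BPALM converges to $\boldsymbol x^\star$, and that $\varphi$ satisfies the KL inequality of Łojasiewicz type at $\boldsymbol x^\star$ with exponent $\theta\in[0,1)$. Then $\varphi(\boldsymbol x^\star)<\infty$ and, with $\mathcal S_k=\varphi(\boldsymbol x^k)-\varphi(\boldsymbol x^\star)$: 1. If $\theta=0$, then $\boldsymbol x^k=\boldsymbol x^\star$ and $\varphi(\boldsymbol x^k)=\varphi(\boldsymbol x^\star)$ for all sufficiently large $k$. 2. If $\theta\in(0,\tfrac12]$, there exist $\lambda_1,\mu_1>0$, $\tau,\overline\tau\in[0,1)$ and $\overline k\in\mathbb N$ such that $0\le\|\boldsymbol x^k-\boldsymbol x^\star\|\le\lambda_1\tau^k$ and $0\le\mathcal S_k\le\mu_1\overline\tau^{\,k}$ for all $k\ge\overline k$. 3. If $\theta\in(\tfrac12,1)$,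 there exist $\lambda_2,\mu_2>0$ and $\overline k\in\mathbb N$ such that $0\le\|\boldsymbol x^k-\boldsymbol x^\star\|\le\lambda_2k^{-\frac{1-\theta}{2\theta-1}}$ and $0\le\mathcal S_k\le\mu_2k^{-\frac{1-\theta}{2\theta-1}}$ for all $k\ge\overline k+1$. -/

import Mathlib

open Filter Topology Bornology

noncomputable section

namespace BPALM

/-! ### Extended-real-valued functions -/

section ExtendedReal

variable {E : Type*}

/-- The (effective) domain of an extended-real-valued function. -/
def dom (F : E → EReal) : Set E := {x | F x < ⊤}

/-- A function is proper if it never takes the value `-∞` and is not identically `+∞`. -/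
def Proper (F : E → EReal) : Prop := (∀ x, F x ≠ ⊥) ∧ (dom F).Nonempty

/-- The set of minimizers; the minimal value has to be `< +∞`. -/
def argmin (F : E → EReal) : Set E := {x | F x < ⊤ ∧ ∀ y, F x ≤ F y}

/-- The real-valued function that agrees with `F` wherever `F` is finite. -/
def realPart (F : E → EReal) : E → ℝ := fun x => (F x).toReal

variable [NormedAddCommGroup E] [InnerProductSpace ℝ E]

/-- Regular (Fréchet) subgradients: `F z ≥ F x + ⟪v, z - x⟫ + o(‖z - x‖)`, where `F x` is finite. -/
def regularSubdifferential (F : E → EReal) (x : E) : Set E :=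
  {v | x ∈ dom F ∧ ∀ c : ℝ, 0 < c →
    ∀ᶠ z in 𝓝 x, F x + ((inner ℝ v (z - x) - c * ‖z - x‖ : ℝ) : EReal) ≤ F z}

/-- The limiting (Mordukhovich) subdifferential; it is empty where `F` is not finite. -/
def subdifferential (F : E → EReal) (x : E) : Set E :=
  {v | x ∈ dom F ∧ ∃ (u w : ℕ → E), Tendsto u atTop (𝓝 x) ∧
    Tendsto (fun k => F (u k)) atTop (𝓝 (F x)) ∧
    (∀ k, w k ∈ regularSubdifferential F (u k)) ∧ Tendsto w atTop (𝓝 v)}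

/-- The Kurdyka-Łojasiewicz inequality at `xs` with desingularizing function
`s ↦ κ / (1 - θ) * s ^ (1 - θ)`, that is, with derivative `κ * s ^ (-θ)`:
`(F x - F xs) ^ θ ≤ κ * dist (0, ∂F x)` for the `x` close to `xs` with `F xs < F x < F xs + η`.
The distance to the empty set is `+∞`. -/
def LojasiewiczAt (F : E → EReal) (xs : E) (θ : ℝ) : Prop :=
  ∃ κ ε η : ℝ, 0 < κ ∧ 0 < ε ∧ 0 < η ∧ ∀ x ∈ Metric.ball xs ε,
    F xs < F x → F x < F xs + (η : EReal) →
      ENNReal.ofReal ((F x - F xs).toReal ^ θ) ≤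
        ENNReal.ofReal κ * Metric.infEDist 0 (subdifferential F x)

end ExtendedReal

/-! ### Block structure -/

/-- `ℝ^{n_1} × ⋯ × ℝ^{n_N}` with the Euclidean norm and inner product. -/
abbrev BlockSpace {N : ℕ} (n : Fin N → ℕ) : Type :=
  PiLp 2 (fun i : Fin N => EuclideanSpace ℝ (Fin (n i)))

variable {N : ℕ} {n : Fin N → ℕ}

/-- The vector `x + U_i (z - x_i)`: block `i` of `x` is replaced by `z`. -/
def replaceBlock (x : BlockSpace n) (i : Fin N) (z : EuclideanSpace ℝ (Fin (n i))) :
    BlockSpace n :=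
  WithLp.toLp 2 (Function.update (WithLp.ofLp x) i z)

/-- The objective `φ(x) = f(x) + ∑ i, g_i(x_i)`. -/
def objective (f : BlockSpace n → EReal) (g : (i : Fin N) → EuclideanSpace ℝ (Fin (n i)) → EReal) :
    BlockSpace n → EReal :=
  fun x => f x + ∑ i, g i (x i)

/-- The slice of `dom h` through `x` in the direction of block `i`, that is, the domain of
`h_x^i : z ↦ h(x + U_i (z - x_i))`. -/
def slice (h : BlockSpace n → EReal) (x : BlockSpace n) (i : Fin N) :
    Set (EuclideanSpace ℝ (Fin (n i))) :=
  {z | replaceBlock x i z ∈ dom h}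

/-- Every `h_x^i`, for `x ∈ dom h`, is strictly convex (on its domain). -/
def MultiBlockStrictlyConvex (h : BlockSpace n → EReal) : Prop :=
  ∀ x ∈ dom h, ∀ i,
    StrictConvexOn ℝ (slice h x i) (fun z => realPart h (replaceBlock x i z))

/-- Every `h_x^i`, for `x ∈ dom h`, is strongly convex (on its domain) with modulus `σ_i > 0`. -/
def MultiBlockStronglyConvex (h : BlockSpace n → EReal) (σ : Fin N → ℝ) : Prop :=
  ∀ i, 0 < σ i ∧ ∀ x ∈ dom h,
    StrongConvexOn (slice h x i) (σ i) (fun z => realPart h (replaceBlock x i z))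

/-- Every `h_x^i`, for `x ∈ dom h`, is 1-coercive: `h_x^i(z) / ‖z‖ → +∞` as `‖z‖ → ∞`. -/
def MultiBlockCoercive (h : BlockSpace n → EReal) : Prop :=
  ∀ x ∈ dom h, ∀ i,
    Tendsto (fun z : EuclideanSpace ℝ (Fin (n i)) => h (replaceBlock x i z) / ((‖z‖ : ℝ) : EReal))
      (cobounded (EuclideanSpace ℝ (Fin (n i)))) (𝓝 ⊤)

/-- `‖∇h(u_k)‖ → ∞` for every sequence in `int dom h` that converges to a boundary point of
`dom h`. This is weaker than asking that every partial gradient blow up. -/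
def EssentiallySmooth (h : BlockSpace n → EReal) : Prop :=
  ∀ (u : ℕ → BlockSpace n) (p : BlockSpace n), (∀ k, u k ∈ interior (dom h)) →
    p ∈ frontier (dom h) → Tendsto u atTop (𝓝 p) →
      Tendsto (fun k => ‖gradient (realPart h) (u k)‖) atTop atTop

/-- `f` is `(L_1, …, L_N)`-smooth relative to `h`: for all `x ∈ dom h` and all `i` the function
`z ↦ L_i h(x + U_i (z - x_i)) - f(x + U_i (z - x_i))`, with values in `ℝ ∪ {+∞}` and domain
`dom h_x^i`, is convex. -/
def RelativelySmooth (f h : BlockSpace n → EReal) (L : Fin N → ℝ) : Prop :=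
  Proper f ∧ LowerSemicontinuous f ∧ dom h ⊆ dom f ∧
    ∀ i, 0 ≤ L i ∧ ∀ x ∈ dom h,
      ConvexOn ℝ (slice h x i)
        (fun z => L i * realPart h (replaceBlock x i z) - realPart f (replaceBlock x i z))

/-- The standing hypotheses on the composite problem
`minimize φ(x) = f(x) + ∑ i, g_i(x_i)` with kernel `h`. -/
structure CompositeProblem (f h : BlockSpace n → EReal)
    (g : (i : Fin N) → EuclideanSpace ℝ (Fin (n i)) → EReal) (L : Fin N → ℝ) : Prop where
  g_proper : ∀ i, Proper (g i)
  g_lsc : ∀ i, LowerSemicontinuous (g i)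
  h_proper : Proper h
  h_lsc : LowerSemicontinuous h
  h_interior : (interior (dom h)).Nonempty
  h_contDiff : ContDiffOn ℝ 1 (realPart h) (interior (dom h))
  h_strictlyConvex : MultiBlockStrictlyConvex h
  h_coercive : MultiBlockCoercive h
  h_essentiallySmooth : EssentiallySmooth h
  f_contDiff : ContDiffOn ℝ 1 (realPart f) (interior (dom h))
  f_smooth : RelativelySmooth f h L
  argmin_nonempty : (argmin (objective f g)).Nonempty
  dom_subset : dom (objective f g) ⊆ interior (dom h)

/-! ### The algorithm -/

open Classical in
/-- The Bregman distance `D_h(y, x)`. -/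
def bregman (h : BlockSpace n → EReal) (y x : BlockSpace n) : EReal :=
  if x ∈ interior (dom h) then
    h y - h x - ((inner ℝ (gradient (realPart h) x) (y - x) : ℝ) : EReal)
  else ⊤

/-- The Bregman proximal alternating linearized mapping in block `i`: the minimizers `z` of
`⟪∇_i f(x), z - x_i⟫ + (1/γ_i) D_h(x + U_i (z - x_i), x) + g_i(z)`.
(The terms `g_j(x_j)`, `j ≠ i`, of the full model do not depend on `z`.)
It is empty unless `x ∈ int dom h`. -/
def proxMap (f h : BlockSpace n → EReal)
    (g : (i : Fin N) → EuclideanSpace ℝ (Fin (n i)) → EReal) (γ : Fin N → ℝ)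
    (i : Fin N) (x : BlockSpace n) : Set (EuclideanSpace ℝ (Fin (n i))) :=
  argmin fun z =>
    ((inner ℝ (gradient (realPart f) x i) (z - x i) : ℝ) : EReal)
      + ((1 / γ i : ℝ) : EReal) * bregman h (replaceBlock x i z) x + g i z

/-- The intermediate iterate `x^{k,m} = (x_1^{k+1}, …, x_m^{k+1}, x_{m+1}^k, …, x_N^k)`, whose first
`m` blocks are already updated. -/
def intermediate (x : ℕ → BlockSpace n) (k m : ℕ) : BlockSpace n :=
  WithLp.toLp 2 fun j : Fin N => if (j : ℕ) < m then x (k + 1) j else x k j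

/-- `x` is an infinite sequence generated by BPALM with step sizes `γ`. Blocks are numbered from
`0`, so that the blocks before block `i` are exactly the first `i` ones. -/
def IsSequence (f h : BlockSpace n → EReal)
    (g : (i : Fin N) → EuclideanSpace ℝ (Fin (n i)) → EReal) (γ : Fin N → ℝ)
    (x : ℕ → BlockSpace n) : Prop :=
  ∀ (k : ℕ) (i : Fin N), x (k + 1) i ∈ proxMap f h g γ i (intermediate x k i)

end BPALM

end

/-! Three facts drive the proof. Each sweep decreases the objective by at least a multiple of the
squared step length (`sweep_descent`): minimality of a block step, strong convexity of `h` and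
convexity of `L_i h - f` in that block give the gain, and summing over blocks telescopes `f`. After
each late sweep there is a subgradient of norm at most a multiple of the step
(`exists_subgradient_bound`): the optimality conditions express it through gradient differences at
points one sweep apart, where the gradients are Lipschitz. The objective values converge to the
value at the limit (`tendsto_objectiveReal`): lower semicontinuity gives one inequality, and using
the limit's block as competitor in the proximal step gives the other.

Together with the Łojasiewicz inequality these give, for the value gaps `S k` and steps `Δ k = ‖x (k
+ 1) - x k‖`, the scalar system `ρ Δ_k ^ 2 ≤ S_k - S_{k+1}` and `S_{k+1} ^ θ ≤ B Δ_k`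
(`exists_tail_estimates`). Eliminating `Δ_k` leaves `S_{k+1} ^ (2 θ) ≤ C (S_k - S_{k+1})`, which
yields geometric decay for `θ ≤ 1/2` and polynomial decay for `θ > 1/2`. For `θ = 0` the second
inequality keeps the steps away from zero while the gap is positive, so the gap must vanish after
finitely many sweeps. Rates for the iterates come from bounding the remaining path length. -/

namespace BPALM

/-! ### Rates from scalar recursions -/

/-- Tangent inequality for the concave power `t ↦ t ^ (1 - θ)`. -/
lemma rpow_one_sub_tangent {a b θ : ℝ} (ha : 0 < a) (hb : 0 ≤ b) (h0 : 0 ≤ θ) (h1 : θ ≤ 1) :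
    (1 - θ) * (a - b) ≤ a ^ θ * (a ^ (1 - θ) - b ^ (1 - θ)) := by
  -- Bernoulli's inequality with exponent in `[0, 1]`, applied to the ratio `b / a`.
  have h := rpow_one_add_le_one_add_mul_self (s := b / a - 1)
    (by have : 0 ≤ b / a := by positivity
        linarith) (p := 1 - θ) (by linarith) (by linarith)
  have e : 1 + (b / a - 1) = b / a := by ring
  rw [e, Real.div_rpow hb ha.le, div_le_iff₀ (Real.rpow_pos_of_pos ha _)] at h
  have hprod : a ^ θ * a ^ (1 - θ) = a := by
    rw [← Real.rpow_add ha]; simp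
  have hθ : 0 ≤ a ^ θ := (Real.rpow_pos_of_pos ha _).le
  have h' := mul_le_mul_of_nonneg_left h hθ
  have e2 : a ^ θ * ((1 + (1 - θ) * (b / a - 1)) * a ^ (1 - θ))
      = a + (1 - θ) * (b - a) := by
    calc _ = (1 + (1 - θ) * (b / a - 1)) * (a ^ θ * a ^ (1 - θ)) := by ring
      _ = _ := by rw [hprod]; field_simp
  nlinarith

/-- The distance to the limit is bounded by a telescoping majorant of the step lengths. -/
lemma norm_sub_limit_le_of_telescoping {E : Type*} [NormedAddCommGroup E] {x : ℕ → E} {xs : E}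
    (hlim : Tendsto x atTop (𝓝 xs)) {V : ℕ → ℝ} {K : ℕ} (hV : ∀ k ≥ K, 0 ≤ V k)
    (h : ∀ k ≥ K, ‖x (k + 1) - x k‖ ≤ V k - V (k + 1)) :
    ∀ k ≥ K, ‖x k - xs‖ ≤ V k := by
  intro k hk
  have key : ∀ m, ‖x (k + m) - x k‖ ≤ V k - V (k + m) := by
    intro m
    induction m with
    | zero => simp
    | succ m ih =>
      have := h (k + m) (by omega)
      calc ‖x (k + (m + 1)) - x k‖ = ‖(x (k + m + 1) - x (k + m)) + (x (k + m) - x k)‖ := by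
            rw [sub_add_sub_cancel]; rfl
        _ ≤ _ := norm_add_le _ _
        _ ≤ (V (k + m) - V (k + m + 1)) + (V k - V (k + m)) := add_le_add this ih
        _ = V k - V (k + (m + 1)) := by rw [← add_assoc]; ring
  have hl : Tendsto (fun m => ‖x (k + m) - x k‖) atTop (𝓝 ‖xs - x k‖) := by
    have : Tendsto (fun m => x (k + m)) atTop (𝓝 xs) := by
      simpa [add_comm] using (tendsto_add_atTop_iff_nat k).2 hlim
    exact (this.sub_const _).norm
  rw [norm_sub_rev]
  refine le_of_tendsto hl (Eventually.of_forall fun m => (key m).trans ?_)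
  linarith [hV (k + m) (by omega)]

/-- Linear decay of values and iterates. -/
lemma linear_rate {E : Type*} [NormedAddCommGroup E] {x : ℕ → E} {xs : E}
    (hlim : Tendsto x atTop (𝓝 xs)) {S : ℕ → ℝ} {K : ℕ} {ρ C : ℝ} (hρ : 0 < ρ) (hC : 0 < C)
    (hS : ∀ k ≥ K, 0 ≤ S k)
    (hdesc : ∀ k ≥ K, ρ * ‖x (k + 1) - x k‖ ^ 2 ≤ S k - S (k + 1))
    (hrec : ∀ k ≥ K, S (k + 1) ≤ C * (S k - S (k + 1))) :
    ∃ lam μ τ τ' : ℝ, 0 < lam ∧ 0 < μ ∧ τ ∈ Set.Ico 0 1 ∧ τ' ∈ Set.Ico 0 1 ∧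
      ∀ k ≥ K, ‖x k - xs‖ ≤ lam * τ ^ k ∧ S k ≤ μ * τ' ^ k := by
  -- The ratio obtained by solving `S_{k+1} ≤ C (S_k - S_{k+1})` for `S_{k+1}`.
  set τ' : ℝ := C / (1 + C) with hτ'
  have hτ0 : 0 < τ' := by positivity
  have hτ1 : τ' < 1 := by rw [hτ', div_lt_one (by positivity)]; linarith
  have hstep : ∀ k ≥ K, S (k + 1) ≤ τ' * S k := by
    intro k hk
    rw [hτ', div_mul_eq_mul_div, le_div_iff₀ (by positivity)]
    linarith [hrec k hk]
  -- Normalized so that the bound holds at `K`; the `+ 1` keeps `μ` positive when `S K = 0`.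
  set μ : ℝ := (S K + 1) / τ' ^ K with hμ
  have hμ0 : 0 < μ := by have := hS K le_rfl; positivity
  have hSb : ∀ k ≥ K, S k ≤ μ * τ' ^ k := by
    intro k hk
    induction k, hk using Nat.le_induction with
    | base => rw [hμ, div_mul_cancel₀ _ (by positivity)]; linarith
    | succ k hk ih =>
      calc S (k + 1) ≤ τ' * S k := hstep k hk
        _ ≤ τ' * (μ * τ' ^ k) := by gcongr
        _ = _ := by ring
  -- Squared steps are controlled by the gaps, so steps decay at the square root of their ratio.
  set τ := √τ' with hτ
  have ht0 : 0 < τ := Real.sqrt_pos.2 hτ0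
  have ht1 : τ < 1 := by rw [hτ, Real.sqrt_lt' one_pos]; simpa
  have hΔ : ∀ k ≥ K, ‖x (k + 1) - x k‖ ≤ √(μ / ρ) * τ ^ k := by
    intro k hk
    have h1 : ‖x (k + 1) - x k‖ ^ 2 ≤ μ / ρ * τ' ^ k := by
      rw [div_mul_eq_mul_div, le_div_iff₀ hρ]
      linarith [hdesc k hk, hS (k + 1) (by omega), hSb k hk]
    refine (sq_le_sq₀ (by positivity) (by positivity)).1 ?_
    rw [mul_pow, Real.sq_sqrt (by positivity), ← pow_mul, mul_comm k 2, pow_mul,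
      hτ, Real.sq_sqrt hτ0.le]
    exact h1
  have h1τ : 0 < 1 - τ := by linarith
  have hlamb : 0 < √(μ / ρ) := Real.sqrt_pos.2 (by positivity)
  refine ⟨√(μ / ρ) / (1 - τ), μ, τ, τ', by positivity, hμ0, ⟨ht0.le, ht1⟩, ⟨hτ0.le, hτ1⟩, ?_⟩
  -- `V k` is the tail of the geometric series bounding the steps.
  have := norm_sub_limit_le_of_telescoping hlim (V := fun k => √(μ / ρ) / (1 - τ) * τ ^ k)
    (K := K) (fun k _ => by positivity) (fun k hk => (hΔ k hk).trans_eq (by field_simp; ring))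
  exact fun k hk => ⟨this k hk, hSb k hk⟩

/-- The recursion `s_{k+1} ^ (1 + q) ≤ C (s_k - s_{k+1})` forces `s_k = O(k ^ (-1 / q))`. -/
lemma sublinear_decay {s : ℕ → ℝ} {K : ℕ} {q C : ℝ} (hq0 : 0 < q) (hq1 : q ≤ 1) (hC : 0 < C)
    (hs : ∀ k ≥ K, 0 < s k) (hsC : ∀ k ≥ K, s k ^ q ≤ C)
    (hrec : ∀ k ≥ K, s (k + 1) * s (k + 1) ^ q ≤ C * (s k - s (k + 1))) :
    ∃ c : ℝ, 0 < c ∧ ∃ K' ≥ K, ∀ k ≥ K', s k ^ q ≤ c / ((k : ℝ) + 1) := by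
  -- The reciprocals of `s_k ^ q` grow by at least a fixed amount per step, hence linearly.
  have hinc : ∀ k ≥ K, q / (2 * C) ≤ (s (k + 1) ^ q)⁻¹ - (s k ^ q)⁻¹ := by
    intro k hk
    have hb := hs (k + 1) (by omega)
    have ha := hs k hk
    set b := s (k + 1) with hbd
    set a := s k with had
    have hB : 0 < b ^ q := Real.rpow_pos_of_pos hb _
    have hA : 0 < a ^ q := Real.rpow_pos_of_pos ha _
    have hbC : b ^ q ≤ C := hsC (k + 1) (by omega)
    have h := rpow_one_add_le_one_add_mul_self (s := b / a - 1)
      (by have : 0 ≤ b / a := by positivity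
          linarith) (p := q) hq0.le hq1
    have e : 1 + (b / a - 1) = b / a := by ring
    rw [e, Real.div_rpow hb.le ha.le, div_le_iff₀ hA] at h
    have h2 : b / a - 1 ≤ - (b ^ q / (2 * C)) := by
      have h3 : b * (C + b ^ q) ≤ C * a := by linarith [hrec k hk]
      have h4 : b / a ≤ C / (C + b ^ q) := by
        rw [div_le_div_iff₀ ha (by positivity)]; exact h3
      -- With `t = b ^ q / C ≤ 1` this is `1 / (1 + t) ≤ 1 - t / 2`; the bound `hsC` enters here.
      have h5 : C / (C + b ^ q) ≤ 1 - b ^ q / (2 * C) := by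
        rw [div_le_iff₀ (by positivity)]
        have : (1 - b ^ q / (2 * C)) * (C + b ^ q) = C + b ^ q / 2 * (1 - b ^ q / C) := by
          field_simp; ring
        rw [this]
        have : b ^ q / C ≤ 1 := (div_le_one hC).2 hbC
        have : 0 ≤ b ^ q / 2 * (1 - b ^ q / C) := mul_nonneg (by positivity) (by linarith)
        linarith
      linarith
    have h6 : b ^ q ≤ (1 - q * (b ^ q / (2 * C))) * a ^ q := by
      refine h.trans (mul_le_mul_of_nonneg_right ?_ hA.le)
      nlinarith
    have h7 : q / (2 * C) * (b ^ q * a ^ q) ≤ a ^ q - b ^ q := by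
      calc _ = a ^ q - (1 - q * (b ^ q / (2 * C))) * a ^ q := by ring
        _ ≤ _ := by linarith
    rw [inv_sub_inv hB.ne' hA.ne', le_div_iff₀ (by positivity)]
    exact h7
  have hlow : ∀ m : ℕ, q / (2 * C) * m ≤ (s (K + m) ^ q)⁻¹ := by
    intro m
    induction m with
    | zero => simpa using (Real.rpow_pos_of_pos (hs K le_rfl) q).le
    | succ m ih =>
      have := hinc (K + m) (by omega)
      push_cast
      rw [← add_assoc]
      linarith
  -- For `k ≥ 2K + 1` one has `k - K ≥ (k + 1) / 2`, so the offset `K` costs only a factor 2.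
  refine ⟨4 * C / q, by positivity, 2 * K + 1, by omega, fun k hk => ?_⟩
  have hpos := Real.rpow_pos_of_pos (hs k (by omega)) q
  have h1 := hlow (k - K)
  rw [Nat.add_sub_cancel' (by omega : K ≤ k), Nat.cast_sub (by omega)] at h1
  have hk' : (2 * K + 1 : ℝ) ≤ k := by exact_mod_cast hk
  have h2 : q / (4 * C) * (k + 1) ≤ (s k ^ q)⁻¹ := by
    refine le_trans ?_ h1
    have : q / (4 * C) * ((k : ℝ) + 1) = q / (2 * C) * ((k + 1) / 2) := by field_simp; norm_num
    rw [this]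
    gcongr
    linarith
  rw [le_inv_comm₀ (by positivity) hpos] at h2
  refine h2.trans_eq ?_
  field_simp

/-- Sublinear decay of values and iterates. -/
lemma sublinear_rate {E : Type*} [NormedAddCommGroup E] {x : ℕ → E} {xs : E}
    (hlim : Tendsto x atTop (𝓝 xs)) {S : ℕ → ℝ} {K : ℕ} {ρ B θ : ℝ} (hρ : 0 < ρ) (hB : 0 < B)
    (hθ : 1 / 2 < θ) (hθ1 : θ < 1) (hS : ∀ k ≥ K, 0 < S k) (hS1 : ∀ k ≥ K, S k ≤ 1)
    (hdesc : ∀ k ≥ K, ρ * ‖x (k + 1) - x k‖ ^ 2 ≤ S k - S (k + 1))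
    (hKL : ∀ k ≥ K, S (k + 1) ^ θ ≤ B * ‖x (k + 1) - x k‖) :
    ∃ lam μ : ℝ, 0 < lam ∧ 0 < μ ∧ ∃ K' : ℕ, ∀ k ≥ K' + 1,
      ‖x k - xs‖ ≤ lam * (k : ℝ) ^ (-((1 - θ) / (2 * θ - 1))) ∧
      S k ≤ μ * (k : ℝ) ^ (-((1 - θ) / (2 * θ - 1))) := by
  have hq : 0 < 2 * θ - 1 := by linarith
  have hanti : ∀ k ≥ K, S (k + 1) ≤ S k := fun k hk => by
    have := hdesc k hk
    have : 0 ≤ ρ * ‖x (k + 1) - x k‖ ^ 2 := by positivity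
    linarith
  -- Squared Łojasiewicz bound combined with descent, using `2θ = 1 + q` with `q = 2θ - 1`. The `+
  -- 1` makes the constant at least 1, hence an upper bound for `S_k ^ q`.
  have hrec : ∀ k ≥ K, S (k + 1) * S (k + 1) ^ (2 * θ - 1) ≤
      (B ^ 2 / ρ + 1) * (S k - S (k + 1)) := by
    intro k hk
    have hp := hS (k + 1) (by omega)
    have e : S (k + 1) * S (k + 1) ^ (2 * θ - 1) = (S (k + 1) ^ θ) ^ 2 := by
      rw [← Real.rpow_one_add' hp.le (by linarith), ← Real.rpow_natCast, ← Real.rpow_mul hp.le]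
      congr 1; push_cast; ring
    rw [e]
    calc (S (k + 1) ^ θ) ^ 2 ≤ (B * ‖x (k + 1) - x k‖) ^ 2 := by
          gcongr
          exact hKL k hk
      _ = B ^ 2 / ρ * (ρ * ‖x (k + 1) - x k‖ ^ 2) := by field_simp
      _ ≤ B ^ 2 / ρ * (S k - S (k + 1)) := by
          gcongr
          exact hdesc k hk
      _ ≤ _ := by nlinarith [hanti k hk]
  have hC : 0 < B ^ 2 / ρ + 1 := by positivity
  obtain ⟨c, hc, K', hK', hdec⟩ := sublinear_decay hq (by linarith) hC hS
    (fun k hk => (Real.rpow_le_one (hS k hk).le (hS1 k hk) hq.le).trans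
      (by have : 0 ≤ B ^ 2 / ρ := by positivity
          linarith)) hrec
  set a : ℝ := (1 - θ) / (2 * θ - 1) with ha
  have ha0 : 0 < a := div_pos (by linarith) hq
  have hψ : ∀ k ≥ K', S k ^ (1 - θ) ≤ c ^ a * ((k : ℝ) + 1) ^ (-a) := by
    intro k hk
    have hp := hS k (by omega)
    have e : S k ^ (1 - θ) = (S k ^ (2 * θ - 1)) ^ a := by
      rw [← Real.rpow_mul hp.le, ha, mul_div_cancel₀ _ hq.ne']
    rw [e, Real.rpow_neg (by positivity), ← div_eq_mul_inv, ← Real.div_rpow hc.le (by positivity)]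
    exact Real.rpow_le_rpow (Real.rpow_pos_of_pos hp _).le (hdec k hk) ha0.le
  set M : ℝ := B / (ρ * (1 - θ)) with hM
  have hM0 : 0 < M := div_pos hB (mul_pos hρ (by linarith))
  -- Descent, concavity of `t ↦ t ^ (1 - θ)` and the Łojasiewicz bound give `v ^ 2 ≤ u * (M * D)`
  -- for consecutive steps `u`, `v`. By AM-GM `2 v ≤ u + M D`, and moving one `v` across leaves a
  -- telescoping majorant.
  have htel : ∀ k ≥ K', ‖x (k + 2) - x (k + 1)‖ ≤
      (‖x (k + 1) - x k‖ + M * S (k + 1) ^ (1 - θ)) -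
        (‖x (k + 2) - x (k + 1)‖ + M * S (k + 2) ^ (1 - θ)) := by
    intro k hk
    have h1 := rpow_one_sub_tangent (hS (k + 1) (by omega)) (hS (k + 2) (by omega)).le
      (by linarith : 0 ≤ θ) hθ1.le
    have h2 := hdesc (k + 1) (by omega)
    have h3 := hKL k (by omega)
    have h4 : 0 ≤ S (k + 1) ^ (1 - θ) - S (k + 2) ^ (1 - θ) :=
      sub_nonneg.2 (Real.rpow_le_rpow (hS (k + 2) (by omega)).le (hanti (k + 1) (by omega))
        (by linarith))
    set D := S (k + 1) ^ (1 - θ) - S (k + 2) ^ (1 - θ) with hD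
    set u := ‖x (k + 1) - x k‖ with hu
    have h2' : ρ * ‖x (k + 2) - x (k + 1)‖ ^ 2 ≤ S (k + 1) - S (k + 2) := h2
    set v := ‖x (k + 2) - x (k + 1)‖ with hv
    have hu0 : 0 ≤ u := norm_nonneg _
    have hv0 : 0 ≤ v := norm_nonneg _
    have h5 : v ^ 2 ≤ u * (M * D) := by
      have : (1 - θ) * (ρ * v ^ 2) ≤ B * u * D := by
        calc (1 - θ) * (ρ * v ^ 2) ≤ (1 - θ) * (S (k + 1) - S (k + 2)) := by
              gcongr
          _ ≤ _ := h1
          _ ≤ _ := by gcongr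
      have e : u * (M * D) = B * u * D / (ρ * (1 - θ)) := by rw [hM]; ring
      rw [e, le_div_iff₀ (mul_pos hρ (by linarith))]
      linarith
    have h6 : 2 * v ≤ u + M * D := by
      have : 0 ≤ M * D := by positivity
      refine (sq_le_sq₀ (by positivity) (by positivity)).1 ?_
      nlinarith [sq_nonneg (u - M * D)]
    have e : M * D = M * S (k + 1) ^ (1 - θ) - M * S (k + 2) ^ (1 - θ) := by rw [hD]; ring
    linarith
  have hdist := norm_sub_limit_le_of_telescoping (x := fun k => x (k + 1)) (xs := xs)
    ((tendsto_add_atTop_iff_nat 1).2 hlim) (K := K')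
    (V := fun k => ‖x (k + 1) - x k‖ + M * S (k + 1) ^ (1 - θ))
    (fun k hk => by have := (Real.rpow_pos_of_pos (hS (k + 1) (by omega)) (1 - θ)); positivity) htel
  refine ⟨(√(1 / ρ) + M) * c ^ a, c ^ a, by positivity, by positivity, K', fun k hk => ?_⟩
  -- The majorant at index `k + 1` is estimated through `S k`, whose bound involves `k + 1`; this is
  -- why the range starts at `K' + 1`.
  obtain ⟨k, rfl⟩ : ∃ j, k = j + 1 := ⟨k - 1, by omega⟩
  have hkK : k ≥ K' := by omega
  have hp := hS k (by omega)
  have hp1 := hS (k + 1) (by omega)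
  have hmono : S (k + 1) ^ (1 - θ) ≤ S k ^ (1 - θ) :=
    Real.rpow_le_rpow hp1.le (hanti k (by omega)) (by linarith)
  have hcast : ((k + 1 : ℕ) : ℝ) = (k : ℝ) + 1 := by push_cast; ring
  rw [hcast]
  constructor
  · have hΔ : ‖x (k + 1) - x k‖ ≤ √(1 / ρ) * S k ^ (1 - θ) := by
      refine (sq_le_sq₀ (by positivity) (by positivity)).1 ?_
      rw [mul_pow, Real.sq_sqrt (by positivity), ← Real.rpow_natCast (S k ^ (1 - θ)),
        ← Real.rpow_mul hp.le]
      -- Valid because `S k ≤ 1` and `2 (1 - θ) ≤ 1`.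
      have : S k ≤ S k ^ ((1 - θ) * (2 : ℕ)) := by
        conv_lhs => rw [← Real.rpow_one (S k)]
        exact Real.rpow_le_rpow_of_exponent_ge hp (hS1 k (by omega)) (by push_cast; linarith)
      rw [one_div_mul_eq_div, le_div_iff₀ hρ]
      linarith [hdesc k (by omega)]
    calc ‖x (k + 1) - xs‖ ≤ ‖x (k + 1) - x k‖ + M * S (k + 1) ^ (1 - θ) := hdist k hkK
      _ ≤ √(1 / ρ) * S k ^ (1 - θ) + M * S k ^ (1 - θ) := by gcongr
      _ = (√(1 / ρ) + M) * S k ^ (1 - θ) := by ring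
      _ ≤ (√(1 / ρ) + M) * (c ^ a * ((k : ℝ) + 1) ^ (-a)) := by
          gcongr
          exact hψ k hkK
      _ = _ := by ring
  · calc S (k + 1) ≤ S (k + 1) ^ (1 - θ) := by
          conv_lhs => rw [← Real.rpow_one (S (k + 1))]
          exact Real.rpow_le_rpow_of_exponent_ge hp1 (hS1 _ (by omega)) (by linarith)
      _ ≤ S k ^ (1 - θ) := hmono
      _ ≤ _ := hψ k hkK

/-! ### Strong convexity and block calculus -/

/-- The tangent inequality of a strongly convex function. -/
lemma strongConvexOn_tangent {E : Type*} [NormedAddCommGroup E] [NormedSpace ℝ E] {s : Set E}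
    {m d : ℝ} {F : E → ℝ} {a b : E} (hF : StrongConvexOn s m F) (ha : a ∈ s) (hb : b ∈ s)
    (hd : HasLineDerivAt ℝ F d a (b - a)) :
    F a + d + m / 2 * ‖b - a‖ ^ 2 ≤ F b := by
  have h1 := HasDerivAt.tendsto_slope_zero_right hd
  have h2 : Tendsto (fun t : ℝ => F b - F a - (1 - t) * (m / 2 * ‖b - a‖ ^ 2)) (𝓝[>] 0)
      (𝓝 (F b - F a - (1 - 0) * (m / 2 * ‖b - a‖ ^ 2))) := by
    refine Tendsto.mono_left ?_ nhdsWithin_le_nhds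
    exact Continuous.tendsto (by fun_prop) 0
  -- Convexity on the segment, divided by `t`, bounds the difference quotient; then `t ↓ 0`. Only
  -- the derivative in the direction `b - a` is needed.
  have h3 : d ≤ F b - F a - (1 - 0) * (m / 2 * ‖b - a‖ ^ 2) := by
    refine le_of_tendsto_of_tendsto h1 h2 ?_
    filter_upwards [Ioo_mem_nhdsGT (zero_lt_one' ℝ)] with t ht
    have h := hF.2 ha hb (sub_nonneg.2 ht.2.le) ht.1.le (sub_add_cancel 1 t)
    have e : (1 - t) • a + t • b = a + (0 + t) • (b - a) := by module
    simp only [e, smul_eq_mul] at h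
    rw [norm_sub_rev a b] at h
    simp only [zero_smul, add_zero, smul_eq_mul]
    rw [inv_mul_le_iff₀ ht.1]
    linarith
  linarith

section Block

variable {N : ℕ} {n : Fin N → ℕ}

lemma replaceBlock_self (x : BlockSpace n) (i : Fin N) : replaceBlock x i (x i) = x := by
  ext j : 1
  simp [replaceBlock]

lemma replaceBlock_add (x : BlockSpace n) (i : Fin N) (z w : EuclideanSpace ℝ (Fin (n i))) :
    replaceBlock x i (z + w) = replaceBlock x i z + PiLp.single 2 i w := by
  ext j : 1
  by_cases hj : j = i
  · subst hj; simp [replaceBlock]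
  · simp [replaceBlock, hj]

lemma replaceBlock_sub (x : BlockSpace n) (i : Fin N) (z w : EuclideanSpace ℝ (Fin (n i))) :
    replaceBlock x i z - replaceBlock x i w = PiLp.single 2 i (z - w) := by
  have := replaceBlock_add x i w (z - w)
  rw [add_sub_cancel] at this
  rw [this, add_sub_cancel_left]

lemma inner_single_right (v : BlockSpace n) (i : Fin N) (w : EuclideanSpace ℝ (Fin (n i))) :
    inner ℝ v (PiLp.single 2 i w : BlockSpace n) = inner ℝ (v i) w := by
  rw [PiLp.inner_apply, Finset.sum_eq_single i]
  · simp
  · intro j _ hj; simp [hj]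
  · simp

lemma inner_replaceBlock_sub (v x : BlockSpace n) (i : Fin N)
    (z : EuclideanSpace ℝ (Fin (n i))) :
    inner ℝ v (replaceBlock x i z - x) = inner ℝ (v i) (z - x i) := by
  have h := replaceBlock_sub x i z (x i)
  rw [replaceBlock_self] at h
  rw [h, inner_single_right]

lemma continuous_replaceBlock (i : Fin N) :
    Continuous fun p : BlockSpace n × EuclideanSpace ℝ (Fin (n i)) =>
      replaceBlock p.1 i p.2 := by
  refine (PiLp.continuous_toLp 2 _).comp ?_
  exact ((PiLp.continuous_ofLp 2 _).comp continuous_fst).update i continuous_snd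

lemma norm_block_le (x : BlockSpace n) (i : Fin N) : ‖x i‖ ≤ ‖x‖ := PiLp.norm_apply_le x i

lemma norm_le_sum_norm_block (x : BlockSpace n) : ‖x‖ ≤ ∑ i, ‖x i‖ := by
  have e : x = ∑ i, (PiLp.single 2 i (x i) : BlockSpace n) := by
    ext j : 1
    rw [WithLp.ofLp_sum, Finset.sum_apply, Finset.sum_eq_single j]
    · simp
    · intro i _ hi; simp [Ne.symm hi]
    · simp
  conv_lhs => rw [e]
  refine (norm_sum_le _ _).trans_eq ?_
  simp only [PiLp.norm_single]

lemma norm_le_of_block_le {x y : BlockSpace n} (h : ∀ i, ‖x i‖ ≤ ‖y i‖) : ‖x‖ ≤ ‖y‖ := by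
  rw [PiLp.norm_eq_of_L2, PiLp.norm_eq_of_L2]
  gcongr with i
  exact h i

/-- The directional derivative of a block slice. -/
lemma hasLineDerivAt_slice {H : BlockSpace n → ℝ} {x : BlockSpace n}
    (hH : DifferentiableAt ℝ H x) (i : Fin N) (v : EuclideanSpace ℝ (Fin (n i))) :
    HasLineDerivAt ℝ (fun z => H (replaceBlock x i z)) (inner ℝ (gradient H x i) v) (x i) v := by
  have h := hH.hasGradientAt.hasFDerivAt.hasLineDerivAt (PiLp.single 2 i v)
  rw [InnerProductSpace.toDual_apply_apply, inner_single_right] at h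
  unfold HasLineDerivAt at h ⊢
  convert h using 3 with t
  rw [replaceBlock_add, replaceBlock_self]
  congr 1
  ext j : 1
  by_cases hj : j = i
  · subst hj; simp
  · simp [hj]

/-! ### Intermediate iterates -/

lemma intermediate_zero (x : ℕ → BlockSpace n) (k : ℕ) : intermediate x k 0 = x k := by
  ext j : 1
  simp [intermediate]

lemma intermediate_last (x : ℕ → BlockSpace n) (k : ℕ) : intermediate x k N = x (k + 1) := by
  ext j : 1
  simp [intermediate]

lemma intermediate_apply_self (x : ℕ → BlockSpace n) (k : ℕ) (i : Fin N) :
    intermediate x k i i = x k i := by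
  simp [intermediate]

lemma intermediate_succ (x : ℕ → BlockSpace n) (k : ℕ) (i : Fin N) :
    intermediate x k (i + 1) = replaceBlock (intermediate x k i) i (x (k + 1) i) := by
  ext j : 1
  by_cases hj : j = i
  · subst hj; simp [intermediate, replaceBlock]
  · have : (j : ℕ) ≠ i := fun h => hj (Fin.ext h)
    have h2 : (j : ℕ) < i + 1 ↔ (j : ℕ) < i := by omega
    simp only [intermediate, replaceBlock, h2]
    simp [hj]

/-- Each block of the difference is either zero or the matching block of the full step. -/
lemma norm_sub_intermediate_le (x : ℕ → BlockSpace n) (k m : ℕ) :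
    ‖x (k + 1) - intermediate x k m‖ ≤ ‖x (k + 1) - x k‖ := by
  refine norm_le_of_block_le fun i => ?_
  by_cases h : (i : ℕ) < m <;> simp [intermediate, h]

lemma norm_intermediate_succ_sub_le (x : ℕ → BlockSpace n) (k m : ℕ) :
    ‖intermediate x k (m + 1) - intermediate x k m‖ ≤ ‖x (k + 1) - x k‖ := by
  refine norm_le_of_block_le fun i => ?_
  simp only [intermediate, PiLp.sub_apply]
  by_cases h : (i : ℕ) < m
  · rw [if_pos h, if_pos (Nat.lt_succ_of_lt h)]
    simp
  · by_cases h' : (i : ℕ) < m + 1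
    · rw [if_neg h, if_pos h']
    · rw [if_neg h, if_neg h']
      simp

lemma tendsto_intermediate {x : ℕ → BlockSpace n} {xs : BlockSpace n}
    (hlim : Tendsto x atTop (𝓝 xs)) (m : ℕ) :
    Tendsto (fun k => intermediate x k m) atTop (𝓝 xs) := by
  have h1 : Tendsto (fun k => x (k + 1)) atTop (𝓝 xs) := (tendsto_add_atTop_iff_nat 1).2 hlim
  have h2 : Tendsto (fun k => ‖x (k + 1) - x k‖) atTop (𝓝 0) := by
    simpa using (h1.sub hlim).norm
  have h3 := squeeze_zero_norm (fun k => norm_sub_intermediate_le x k m) h2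
  simpa using h1.sub h3

end Block

/-! ### Extended-real-valued functions -/

section ExtendedReal

lemma coe_realPart {E : Type*} {F : E → EReal} {x : E} (hx : x ∈ dom F) (hF : F x ≠ ⊥) :
    ((realPart F x : ℝ) : EReal) = F x := EReal.coe_toReal (ne_of_lt hx) hF

lemma ereal_coe_sum {ι : Type*} (s : Finset ι) (a : ι → ℝ) :
    ((∑ i ∈ s, a i : ℝ) : EReal) = ∑ i ∈ s, (a i : EReal) := by
  classical
  induction s using Finset.induction_on with
  | empty => simp
  | insert i s hi ih => rw [Finset.sum_insert hi, Finset.sum_insert hi, EReal.coe_add, ih]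

lemma ereal_sum_ne_bot {ι : Type*} (s : Finset ι) {a : ι → EReal} (h : ∀ i ∈ s, a i ≠ ⊥) :
    ∑ i ∈ s, a i ≠ ⊥ := by
  classical
  induction s using Finset.induction_on with
  | empty => simp
  | insert i s hi ih =>
    rw [Finset.sum_insert hi, Ne, EReal.add_eq_bot_iff, not_or]
    exact ⟨h i (Finset.mem_insert_self ..), ih fun j hj => h j (Finset.mem_insert_of_mem hj)⟩

lemma ereal_sum_eq_top {ι : Type*} (s : Finset ι) {a : ι → EReal} (h : ∀ i ∈ s, a i ≠ ⊥)
    {i : ι} (hi : i ∈ s) (hai : a i = ⊤) : ∑ j ∈ s, a j = ⊤ := by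
  classical
  rw [← Finset.add_sum_erase s a hi, hai]
  exact EReal.top_add_of_ne_bot
    (ereal_sum_ne_bot _ fun j hj => h j (Finset.mem_of_mem_erase hj))

lemma lowerSemicontinuous_ereal_add {E : Type*} [TopologicalSpace E] {F G : E → EReal}
    (hF : LowerSemicontinuous F) (hG : LowerSemicontinuous G) (hF' : ∀ x, F x ≠ ⊥)
    (hG' : ∀ x, G x ≠ ⊥) : LowerSemicontinuous fun x => F x + G x :=
  hF.add' hG fun x => EReal.continuousAt_add (Or.inr (hG' x)) (Or.inl (hF' x))

lemma lowerSemicontinuous_ereal_sum {E ι : Type*} [TopologicalSpace E] (s : Finset ι)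
    {F : ι → E → EReal} (hF : ∀ i ∈ s, LowerSemicontinuous (F i)) (hF' : ∀ i ∈ s, ∀ x, F i x ≠ ⊥) :
    LowerSemicontinuous fun x => ∑ i ∈ s, F i x := by
  classical
  induction s using Finset.induction_on with
  | empty => simpa using lowerSemicontinuous_const
  | insert i s hi ih =>
    simp only [Finset.sum_insert hi]
    refine lowerSemicontinuous_ereal_add (hF i (Finset.mem_insert_self ..))
      (ih (fun j hj => hF j (Finset.mem_insert_of_mem hj))
        fun j hj => hF' j (Finset.mem_insert_of_mem hj))
      (hF' i (Finset.mem_insert_self ..))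
      fun x => ereal_sum_ne_bot _ fun j hj => hF' j (Finset.mem_insert_of_mem hj) x

lemma regularSubdifferential_subset {E : Type*} [NormedAddCommGroup E] [InnerProductSpace ℝ E]
    (F : E → EReal) (x : E) : regularSubdifferential F x ⊆ subdifferential F x := fun v hv =>
  ⟨hv.1, fun _ => x, fun _ => v, tendsto_const_nhds, tendsto_const_nhds, fun _ => hv,
    tendsto_const_nhds⟩

end ExtendedReal

/-! ### Finiteness, semicontinuity and subgradients of the objective -/

section Objective

variable {N : ℕ} {n : Fin N → ℕ} {f h : BlockSpace n → EReal}
  {g : (i : Fin N) → EuclideanSpace ℝ (Fin (n i)) → EReal} {L σ γ : Fin N → ℝ}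

/-- The objective as a real number. -/
def objectiveReal (f : BlockSpace n → EReal)
    (g : (i : Fin N) → EuclideanSpace ℝ (Fin (n i)) → EReal) (x : BlockSpace n) : ℝ :=
  realPart f x + ∑ i, realPart (g i) (x i)

lemma mem_dom_objective_iff (hf : ∀ x, f x ≠ ⊥) (hg : ∀ i z, g i z ≠ ⊥) {x : BlockSpace n} :
    x ∈ dom (objective f g) ↔ x ∈ dom f ∧ ∀ i, x i ∈ dom (g i) := by
  constructor
  · intro hx
    have hx' : f x + ∑ i, g i (x i) < ⊤ := hx
    refine ⟨Ne.lt_top (a := f x) fun h => ?_, fun i => Ne.lt_top (a := g i (x i)) fun h => ?_⟩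
    · rw [h, EReal.top_add_of_ne_bot (ereal_sum_ne_bot _ fun i _ => hg i _)] at hx'
      exact lt_irrefl _ hx'
    · rw [ereal_sum_eq_top _ (fun i _ => hg i _) (Finset.mem_univ i) h,
        EReal.add_top_of_ne_bot (hf x)] at hx'
      exact lt_irrefl _ hx'
  · rintro ⟨h1, h2⟩
    change f x + ∑ i, g i (x i) < ⊤
    rw [← coe_realPart h1 (hf x), Finset.sum_congr rfl fun i _ => (coe_realPart (h2 i) (hg i _)).symm,
      ← ereal_coe_sum, ← EReal.coe_add]
    exact EReal.coe_lt_top _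

lemma objective_eq_coe (hf : ∀ x, f x ≠ ⊥) (hg : ∀ i z, g i z ≠ ⊥) {x : BlockSpace n}
    (hx : x ∈ dom (objective f g)) : objective f g x = (objectiveReal f g x : ℝ) := by
  obtain ⟨h1, h2⟩ := (mem_dom_objective_iff hf hg).1 hx
  rw [objectiveReal, EReal.coe_add, ereal_coe_sum, coe_realPart h1 (hf x), objective]
  congr 1
  exact Finset.sum_congr rfl fun i _ => (coe_realPart (h2 i) (hg i _)).symm

lemma lowerSemicontinuous_objective (hf : ∀ x, f x ≠ ⊥) (hg : ∀ i z, g i z ≠ ⊥)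
    (hf' : LowerSemicontinuous f) (hg' : ∀ i, LowerSemicontinuous (g i)) :
    LowerSemicontinuous (objective f g) :=
  lowerSemicontinuous_ereal_add hf'
    (lowerSemicontinuous_ereal_sum _
      (fun i _ x y hy =>
        ((PiLp.continuous_apply 2 _ i).tendsto x).eventually (hg' i (x i) y hy)) fun i _ _ => hg i _) hf
    fun _ => ereal_sum_ne_bot _ fun i _ => hg i _

/-- Sum rule for regular subgradients of the objective. -/
lemma gradient_add_mem_regularSubdifferential (hf : ∀ x, f x ≠ ⊥) (hg : ∀ i z, g i z ≠ ⊥)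
    {x v : BlockSpace n} (hx : x ∈ interior (dom f))
    (hd : DifferentiableAt ℝ (realPart f) x)
    (hv : ∀ i, v i ∈ regularSubdifferential (g i) (x i)) :
    gradient (realPart f) x + v ∈ regularSubdifferential (objective f g) x := by
  have hxd : x ∈ dom (objective f g) :=
    (mem_dom_objective_iff hf hg).2 ⟨interior_subset hx, fun i => (hv i).1⟩
  refine ⟨hxd, fun c hc => ?_⟩
  -- The error budget `c` is shared by `f` and the `N` functions `g i`.
  set c' : ℝ := c / (N + 1) with hc'
  have hc'0 : 0 < c' := by positivity
  have h1 := (hasGradientAt_iff_isLittleO.1 hd.hasGradientAt).def hc'0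
  have h2 : ∀ᶠ z in 𝓝 x, ∀ i, g i (x i) +
      ((inner ℝ (v i) (z i - x i) - c' * ‖z i - x i‖ : ℝ) : EReal) ≤ g i (z i) := by
    refine eventually_all.2 fun i => ?_
    exact ((PiLp.continuous_apply 2 _ i).tendsto x).eventually ((hv i).2 c' hc'0)
  filter_upwards [h1, h2, isOpen_interior.mem_nhds hx] with z hz1 hz2 hz3
  rw [objective_eq_coe hf hg hxd, objective, ← coe_realPart (interior_subset hz3) (hf z)]
  have h3 : ((∑ i, (realPart (g i) (x i) + (inner ℝ (v i) (z i - x i) - c' * ‖z i - x i‖)) : ℝ)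
      : EReal) ≤ ∑ i, g i (z i) := by
    rw [ereal_coe_sum]
    refine Finset.sum_le_sum fun i _ => ?_
    rw [EReal.coe_add, coe_realPart (hv i).1 (hg i _)]
    exact hz2 i
  refine le_trans ?_ (add_le_add_right h3 _)
  rw [← EReal.coe_add, ← EReal.coe_add, EReal.coe_le_coe_iff, objectiveReal, inner_add_left,
    Finset.sum_add_distrib, Finset.sum_sub_distrib]
  have e1 : (inner ℝ v (z - x) : ℝ) = ∑ i, inner ℝ (v i) (z i - x i) := by
    rw [PiLp.inner_apply]; rfl
  have h4 : ∑ i, c' * ‖z i - x i‖ ≤ N * (c' * ‖z - x‖) := by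
    calc ∑ i, c' * ‖z i - x i‖ ≤ ∑ _i : Fin N, c' * ‖z - x‖ := by
          refine Finset.sum_le_sum fun i _ => ?_
          gcongr
          exact norm_block_le (z - x) i
      _ = _ := by simp
  have h5 : N * (c' * ‖z - x‖) + c' * ‖z - x‖ = c * ‖z - x‖ := by
    rw [hc']; field_simp
  have h6 := (abs_le.1 (Real.norm_eq_abs _ ▸ hz1)).1
  rw [e1]
  linarith

end Objective

/-! ### One proximal step and one sweep -/

section Algorithm

variable {N : ℕ} {n : Fin N → ℕ} {f h : BlockSpace n → EReal}
  {g : (i : Fin N) → EuclideanSpace ℝ (Fin (n i)) → EReal} {L σ γ : Fin N → ℝ}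

/-- The smooth part of the block model, as a real number. -/
noncomputable def blockModel (f h : BlockSpace n → EReal) (γ : Fin N → ℝ) (i : Fin N) (x : BlockSpace n)
    (z : EuclideanSpace ℝ (Fin (n i))) : ℝ :=
  inner ℝ (gradient (realPart f) x i) (z - x i) + 1 / γ i *
    (realPart h (replaceBlock x i z) - realPart h x -
      inner ℝ (gradient (realPart h) x i) (z - x i))

lemma blockModel_self (i : Fin N) (x : BlockSpace n) : blockModel f h γ i x (x i) = 0 := by
  simp [blockModel, replaceBlock_self]

lemma bregman_eq_coe (hh : ∀ x, h x ≠ ⊥) {x y : BlockSpace n} (hx : x ∈ interior (dom h))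
    (hy : y ∈ dom h) : bregman h y x =
      ((realPart h y - realPart h x - inner ℝ (gradient (realPart h) x) (y - x) : ℝ) : EReal) := by
  rw [bregman, if_pos hx, EReal.coe_sub, EReal.coe_sub, coe_realPart hy (hh y),
    coe_realPart (interior_subset hx) (hh x)]

lemma coe_blockModel (hh : ∀ x, h x ≠ ⊥) {i : Fin N} {x : BlockSpace n}
    {z : EuclideanSpace ℝ (Fin (n i))} (hx : x ∈ interior (dom h))
    (hz : replaceBlock x i z ∈ dom h) :
    ((inner ℝ (gradient (realPart f) x i) (z - x i) : ℝ) : EReal)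
      + ((1 / γ i : ℝ) : EReal) * bregman h (replaceBlock x i z) x =
      (blockModel f h γ i x z : ℝ) := by
  rw [bregman_eq_coe hh hx hz, ← EReal.coe_mul, ← EReal.coe_add, inner_replaceBlock_sub,
    blockModel]

/-- Real-valued description of the proximal step. -/
lemma mem_proxMap (hh : ∀ x, h x ≠ ⊥) (hg : ∀ i z, g i z ≠ ⊥) {i : Fin N} (hγ : 0 < γ i)
    {x : BlockSpace n} {z : EuclideanSpace ℝ (Fin (n i))} (hz : z ∈ proxMap f h g γ i x) :
    x ∈ interior (dom h) ∧ replaceBlock x i z ∈ dom h ∧ z ∈ dom (g i) ∧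
      ∀ z', replaceBlock x i z' ∈ dom h → z' ∈ dom (g i) →
        blockModel f h γ i x z + realPart (g i) z ≤
          blockModel f h γ i x z' + realPart (g i) z' := by
  obtain ⟨h1, h2⟩ := hz
  beta_reduce at h1 h2
  have hγ' : 0 < 1 / γ i := by positivity
  -- The minimum is finite and no summand is `-∞`, so no summand can be `+∞`. Outside `int dom h`
  -- the Bregman distance is `⊤` by convention.
  have hx : x ∈ interior (dom h) := by
    by_contra hx
    rw [bregman, if_neg hx, EReal.coe_mul_top_of_pos hγ', EReal.coe_add_top,
      EReal.top_add_of_ne_bot (hg i z)] at h1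
    exact lt_irrefl _ h1
  have hy : replaceBlock x i z ∈ dom h := by
    refine Ne.lt_top (a := h (replaceBlock x i z)) fun ht => ?_
    rw [bregman, if_pos hx, ← coe_realPart (interior_subset hx) (hh x), ht, EReal.top_sub_coe,
      EReal.top_sub_coe, EReal.coe_mul_top_of_pos hγ', EReal.coe_add_top,
      EReal.top_add_of_ne_bot (hg i z)] at h1
    exact lt_irrefl _ h1
  have hgz : z ∈ dom (g i) := by
    refine Ne.lt_top (a := g i z) fun ht => ?_
    rw [coe_blockModel hh hx hy, ht, EReal.coe_add_top] at h1
    exact lt_irrefl _ h1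
  refine ⟨hx, hy, hgz, fun z' hz' hgz' => ?_⟩
  have h3 := h2 z'
  rw [coe_blockModel hh hx hy, coe_blockModel hh hx hz', ← coe_realPart hgz (hg i z),
    ← coe_realPart hgz' (hg i z'), ← EReal.coe_add, ← EReal.coe_add, EReal.coe_le_coe_iff] at h3
  exact h3

/-- Sufficient decrease of the objective in one block step. -/
lemma block_descent (hh : ∀ x, h x ≠ ⊥) (hg : ∀ i z, g i z ≠ ⊥) {i : Fin N} (hγ : 0 < γ i)
    (hγL : γ i * L i < 1) (hσ : MultiBlockStronglyConvex h σ) (hfs : RelativelySmooth f h L)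
    {x : BlockSpace n} {z : EuclideanSpace ℝ (Fin (n i))} (hz : z ∈ proxMap f h g γ i x)
    (hfd : DifferentiableAt ℝ (realPart f) x) (hhd : DifferentiableAt ℝ (realPart h) x)
    (hgx : x i ∈ dom (g i)) :
    realPart f (replaceBlock x i z) + realPart (g i) z +
      (1 / γ i - L i) * (σ i / 2) * ‖z - x i‖ ^ 2 ≤ realPart f x + realPart (g i) (x i) := by
  obtain ⟨hx, hy, hgz, hmin⟩ := mem_proxMap hh hg hγ hz
  have hxd : x ∈ dom h := interior_subset hx
  have hself : x i ∈ slice h x i := by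
    change replaceBlock x i (x i) ∈ dom h
    rwa [replaceBlock_self]
  -- The old block is a competitor with model value zero. Below, `h2` bounds the Bregman distance
  -- from below by `σ_i / 2 * ‖z - x i‖ ^ 2`, and `h3` is the descent lemma for `f` relative to `h`;
  -- the gain is `1 / γ_i - L_i` times that distance.
  have h1 := hmin (x i) (by rwa [replaceBlock_self]) hgx
  rw [blockModel_self, zero_add] at h1
  have h2 := strongConvexOn_tangent ((hσ i).2 x hxd) hself hy
    (hasLineDerivAt_slice hhd i (z - x i))
  have h3 := strongConvexOn_tangent (strongConvexOn_zero.2 ((hfs.2.2.2 i).2 x hxd)) hself hy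
    (((hasLineDerivAt_slice hhd i (z - x i)).const_mul (L i)).sub
      (hasLineDerivAt_slice hfd i (z - x i)))
  simp only [replaceBlock_self] at h2 h3
  rw [blockModel] at h1
  have hL : 0 < 1 / γ i - L i := by
    rw [sub_pos, lt_div_iff₀ hγ, mul_comm]; exact hγL
  have h4 := mul_le_mul_of_nonneg_left h2 hL.le
  linarith

/-- Optimality condition of the block step. -/
lemma block_optimality (hh : ∀ x, h x ≠ ⊥) (hg : ∀ i z, g i z ≠ ⊥) {i : Fin N} (hγ : 0 < γ i)
    {x : BlockSpace n} {z : EuclideanSpace ℝ (Fin (n i))} (hz : z ∈ proxMap f h g γ i x)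
    (hy : replaceBlock x i z ∈ interior (dom h))
    (hhd : DifferentiableAt ℝ (realPart h) (replaceBlock x i z)) :
    -gradient (realPart f) x i - (1 / γ i) • (gradient (realPart h) (replaceBlock x i z) i -
      gradient (realPart h) x i) ∈ regularSubdifferential (g i) z := by
  obtain ⟨hx, -, hgz, hmin⟩ := mem_proxMap hh hg hγ hz
  refine ⟨hgz, fun c hc => ?_⟩
  have hcont : Tendsto (replaceBlock x i) (𝓝 z) (𝓝 (replaceBlock x i z)) :=
    ((continuous_replaceBlock i).comp (by fun_prop :
      Continuous fun w : EuclideanSpace ℝ (Fin (n i)) => (x, w))).tendsto z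
  -- Minimality is tested against nearby `w`, with `h` linearized at the new point. The tolerance `γ
  -- i * c` becomes `c` after division by `γ i`.
  have h1 := hcont.eventually
    ((hasGradientAt_iff_isLittleO.1 hhd.hasGradientAt).def (mul_pos hγ hc))
  filter_upwards [h1, hcont.eventually (isOpen_interior.mem_nhds hy)] with w hw1 hw2
  by_cases hgw : w ∈ dom (g i)
  · have h2 := hmin w (interior_subset hw2) hgw
    rw [replaceBlock_sub, inner_single_right, PiLp.norm_single, Real.norm_eq_abs] at hw1
    have h3 := (abs_le.1 hw1).2
    rw [← coe_realPart hgz (hg i z), ← coe_realPart hgw (hg i w), ← EReal.coe_add,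
      EReal.coe_le_coe_iff]
    rw [inner_sub_left, inner_neg_left, real_inner_smul_left, inner_sub_left]
    simp only [blockModel] at h2
    have e : ∀ v : EuclideanSpace ℝ (Fin (n i)),
        (inner ℝ v (w - x i) : ℝ) = inner ℝ v (w - z) + inner ℝ v (z - x i) := fun v => by
      rw [← inner_add_right, sub_add_sub_cancel]
    rw [e, e] at h2
    have h4 := mul_le_mul_of_nonneg_left h3 (by positivity : 0 ≤ 1 / γ i)
    have e2 : 1 / γ i * (γ i * c * ‖w - z‖) = c * ‖w - z‖ := by field_simp
    rw [e2] at h4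
    linarith
  · have : g i w = ⊤ := not_lt_top_iff.1 hgw
    rw [this]; exact le_top

/-- Every iterate lies in `int dom h`. -/
lemma iterate_mem_interior (hP : CompositeProblem f h g L) (hγ : ∀ i, 0 < γ i)
    {x : ℕ → BlockSpace n} (hx : IsSequence f h g γ x) (k : ℕ) : x k ∈ interior (dom h) := by
  rcases Nat.eq_zero_or_pos N with rfl | hN
  -- Without blocks there is no step to give information, but the space is a single point, so `x k`
  -- is the minimizer.
  · obtain ⟨y, hy⟩ := hP.argmin_nonempty
    have e : x k = y := by ext j : 1; exact j.elim0
    exact e ▸ hP.dom_subset hy.1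
  · have := (mem_proxMap hP.h_proper.1 (fun i => (hP.g_proper i).1) (hγ _) (hx k ⟨0, hN⟩)).1
    rwa [intermediate_zero] at this

lemma intermediate_mem_interior (hP : CompositeProblem f h g L) (hγ : ∀ i, 0 < γ i)
    {x : ℕ → BlockSpace n} (hx : IsSequence f h g γ x) (k : ℕ) {m : ℕ} (hm : m ≤ N) :
    intermediate x k m ∈ interior (dom h) := by
  rcases hm.lt_or_eq with hm | rfl
  · exact (mem_proxMap hP.h_proper.1 (fun i => (hP.g_proper i).1) (hγ _) (hx k ⟨m, hm⟩)).1
  · rw [intermediate_last]; exact iterate_mem_interior hP hγ hx _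

/-- Only successors are covered: some `g i` may be `+∞` at the starting block, so the objective at
`x 0` need not be finite. Descent estimates therefore begin at `x 1`. -/
lemma iterate_succ_mem_dom (hP : CompositeProblem f h g L) (hγ : ∀ i, 0 < γ i)
    {x : ℕ → BlockSpace n} (hx : IsSequence f h g γ x) (k : ℕ) :
    x (k + 1) ∈ dom (objective f g) :=
  (mem_dom_objective_iff hP.f_smooth.1.1 fun i => (hP.g_proper i).1).2
    ⟨hP.f_smooth.2.2.1 (interior_subset (iterate_mem_interior hP hγ hx _)), fun i =>
      (mem_proxMap hP.h_proper.1 (fun i => (hP.g_proper i).1) (hγ _) (hx k i)).2.2.1⟩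

lemma CompositeProblem.differentiableAt_f (hP : CompositeProblem f h g L) {x : BlockSpace n}
    (hx : x ∈ interior (dom h)) : DifferentiableAt ℝ (realPart f) x :=
  (hP.f_contDiff.differentiableOn one_ne_zero).differentiableAt (isOpen_interior.mem_nhds hx)

lemma CompositeProblem.differentiableAt_h (hP : CompositeProblem f h g L) {x : BlockSpace n}
    (hx : x ∈ interior (dom h)) : DifferentiableAt ℝ (realPart h) x :=
  (hP.h_contDiff.differentiableOn one_ne_zero).differentiableAt (isOpen_interior.mem_nhds hx)

/-- Sufficient decrease of the objective in one sweep over all blocks. -/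
lemma sweep_descent (hP : CompositeProblem f h g L) (hσ : MultiBlockStronglyConvex h σ)
    (hγ : ∀ i, 0 < γ i ∧ γ i * L i < 1) {x : ℕ → BlockSpace n} (hx : IsSequence f h g γ x) :
    ∃ ρ : ℝ, 0 < ρ ∧ ∀ k, ρ * ‖x (k + 2) - x (k + 1)‖ ^ 2 ≤
      objectiveReal f g (x (k + 1)) - objectiveReal f g (x (k + 2)) := by
  have hpos : ∀ i, 0 < (1 / γ i - L i) * (σ i / 2) := fun i => by
    have : 0 < 1 / γ i - L i := by
      rw [sub_pos, lt_div_iff₀ (hγ i).1, mul_comm]; exact (hγ i).2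
    have := (hσ i).1
    positivity
  obtain ⟨ρ, hρ, hρle⟩ : ∃ ρ : ℝ, 0 < ρ ∧ ∀ i, ρ ≤ (1 / γ i - L i) * (σ i / 2) := by
    rcases isEmpty_or_nonempty (Fin N) with hN | hN
    · exact ⟨1, one_pos, fun i => hN.elim i⟩
    · obtain ⟨i, hi⟩ := Finite.exists_min fun i => (1 / γ i - L i) * (σ i / 2)
      exact ⟨_, hpos i, hi⟩
  refine ⟨ρ, hρ, fun k => ?_⟩
  have hγ' : ∀ i, 0 < γ i := fun i => (hγ i).1
  have hstep : ∀ i : Fin N, realPart f (intermediate x (k + 1) (i + 1)) +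
      (realPart (g i) (x (k + 2) i) - realPart (g i) (x (k + 1) i) +
        ρ * ‖x (k + 2) i - x (k + 1) i‖ ^ 2) ≤ realPart f (intermediate x (k + 1) i) := by
    intro i
    have hint := intermediate_mem_interior hP hγ' hx (k + 1) i.2.le
    have := block_descent hP.h_proper.1 (fun i => (hP.g_proper i).1) (hγ' i) (hγ i).2 hσ
      hP.f_smooth (hx (k + 1) i) (hP.differentiableAt_f hint) (hP.differentiableAt_h hint)
      (by rw [intermediate_apply_self]
          exact ((mem_dom_objective_iff hP.f_smooth.1.1 fun i => (hP.g_proper i).1).1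
            (iterate_succ_mem_dom hP hγ' hx k)).2 i)
    rw [← intermediate_succ, intermediate_apply_self] at this
    have h2 : ρ * ‖x (k + 2) i - x (k + 1) i‖ ^ 2 ≤
      (1 / γ i - L i) * (σ i / 2) * ‖x (k + 2) i - x (k + 1) i‖ ^ 2 := by
      gcongr
      exact hρle i
    have h3 : x (k + 1 + 1) = x (k + 2) := rfl
    rw [h3] at this
    linarith
  -- Summed over the blocks, the values of `f` telescope along the intermediate points and the
  -- squared block steps add up to the squared full step.
  have htel := Finset.sum_le_sum fun i (_ : i ∈ Finset.univ) =>
    le_sub_iff_add_le'.2 (hstep i)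
  rw [Fin.sum_univ_eq_sum_range (fun m : ℕ => realPart f (intermediate x (k + 1) m) -
    realPart f (intermediate x (k + 1) (m + 1))) N,
    Finset.sum_range_sub', intermediate_zero, intermediate_last, Finset.sum_add_distrib,
    Finset.sum_sub_distrib, ← Finset.mul_sum] at htel
  rw [PiLp.norm_sq_eq_of_L2]
  simp only [objectiveReal, PiLp.sub_apply]
  have h3 : x (k + 1 + 1) = x (k + 2) := rfl
  rw [h3] at htel
  linarith

end Algorithm

/-! ### Behaviour along a convergent sequence -/

section Convergence

variable {N : ℕ} {n : Fin N → ℕ} {f h : BlockSpace n → EReal}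
  {g : (i : Fin N) → EuclideanSpace ℝ (Fin (n i)) → EReal} {L σ γ : Fin N → ℝ}
  {x : ℕ → BlockSpace n} {xs : BlockSpace n}

lemma objectiveReal_antitone (hP : CompositeProblem f h g L) (hσ : MultiBlockStronglyConvex h σ)
    (hγ : ∀ i, 0 < γ i ∧ γ i * L i < 1) (hx : IsSequence f h g γ x) :
    Antitone fun k => objectiveReal f g (x (k + 1)) := by
  obtain ⟨ρ, hρ, hdesc⟩ := sweep_descent hP hσ hγ hx
  refine antitone_nat_of_succ_le fun k => ?_
  have h1 := hdesc k
  have h2 : 0 ≤ ρ * ‖x (k + 2) - x (k + 1)‖ ^ 2 := by positivity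
  have h3 : x (k + 1 + 1) = x (k + 2) := rfl
  rw [h3]
  linarith

/-- By lower semicontinuity the objective at the limit is below its value at every iterate. -/
lemma objective_limit_le (hP : CompositeProblem f h g L) (hσ : MultiBlockStronglyConvex h σ)
    (hγ : ∀ i, 0 < γ i ∧ γ i * L i < 1) (hx : IsSequence f h g γ x)
    (hlim : Tendsto x atTop (𝓝 xs)) (k : ℕ) :
    objective f g xs ≤ (objectiveReal f g (x (k + 1)) : ℝ) := by
  have hg : ∀ i z, g i z ≠ ⊥ := fun i => (hP.g_proper i).1
  have hcl : IsClosed (objective f g ⁻¹' Set.Iic (objectiveReal f g (x (k + 1)) : EReal)) :=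
    (lowerSemicontinuous_objective hP.f_smooth.1.1 hg hP.f_smooth.2.1 hP.g_lsc).isClosed_preimage _
  refine hcl.mem_of_tendsto hlim ?_
  filter_upwards [eventually_ge_atTop (k + 1)] with m hm
  obtain ⟨m, rfl⟩ : ∃ j, m = j + 1 := ⟨m - 1, by omega⟩
  change objective f g (x (m + 1)) ≤ _
  rw [objective_eq_coe hP.f_smooth.1.1 hg (iterate_succ_mem_dom hP (fun i => (hγ i).1) hx m),
    EReal.coe_le_coe_iff]
  exact objectiveReal_antitone hP hσ hγ hx (by omega : k ≤ m)

/-- Through `dom_subset` this places the limit in `int dom h`, where both gradients are locally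
Lipschitz. -/
lemma limit_mem_dom (hP : CompositeProblem f h g L) (hσ : MultiBlockStronglyConvex h σ)
    (hγ : ∀ i, 0 < γ i ∧ γ i * L i < 1) (hx : IsSequence f h g γ x)
    (hlim : Tendsto x atTop (𝓝 xs)) : xs ∈ dom (objective f g) :=
  (objective_limit_le hP hσ hγ hx hlim 0).trans_lt (EReal.coe_lt_top _)

lemma continuousAt_gradient {F : BlockSpace n → ℝ} {s : Set (BlockSpace n)} (hs : IsOpen s)
    (hF : LocallyLipschitzOn s (gradient F)) {y : BlockSpace n} (hy : y ∈ s) :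
    ContinuousAt (gradient F) y :=
  hF.continuousOn.continuousAt (hs.mem_nhds hy)

/-- The objective values converge to the value at the limit. -/
lemma tendsto_objectiveReal (hP : CompositeProblem f h g L) (hσ : MultiBlockStronglyConvex h σ)
    (hLipf : LocallyLipschitzOn (interior (dom h)) (gradient (realPart f)))
    (hLiph : LocallyLipschitzOn (interior (dom h)) (gradient (realPart h)))
    (hγ : ∀ i, 0 < γ i ∧ γ i * L i < 1) (hx : IsSequence f h g γ x)
    (hlim : Tendsto x atTop (𝓝 xs)) :
    Tendsto (fun k => objectiveReal f g (x k)) atTop (𝓝 (objectiveReal f g xs)) := by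
  have hg : ∀ i z, g i z ≠ ⊥ := fun i => (hP.g_proper i).1
  have hxs := limit_mem_dom hP hσ hγ hx hlim
  have hint := hP.dom_subset hxs
  have hγ' : ∀ i, 0 < γ i := fun i => (hγ i).1
  have hlim1 : Tendsto (fun k => x (k + 1)) atTop (𝓝 xs) := (tendsto_add_atTop_iff_nat 1).2 hlim
  have hcf := (hP.differentiableAt_f hint).continuousAt
  have hch := (hP.differentiableAt_h hint).continuousAt
  have hblock : ∀ (i : Fin N) {u : ℕ → BlockSpace n} {p : BlockSpace n}, Tendsto u atTop (𝓝 p) →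
      Tendsto (fun k => u k i) atTop (𝓝 (p i)) := fun i u p hu =>
    ((PiLp.continuous_apply 2 _ i).tendsto p).comp hu
  have hmodel : ∀ (i : Fin N) {z : ℕ → EuclideanSpace ℝ (Fin (n i))},
      Tendsto z atTop (𝓝 (xs i)) →
      Tendsto (fun k => blockModel f h γ i (intermediate x k i) (z k)) atTop (𝓝 0) := by
    intro i z hz
    have hu := tendsto_intermediate hlim (i : ℕ)
    have hr : Tendsto (fun k => replaceBlock (intermediate x k i) i (z k)) atTop (𝓝 xs) := by
      have := ((continuous_replaceBlock i).tendsto (xs, xs i)).comp (hu.prodMk_nhds hz)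
      rwa [replaceBlock_self] at this
    have hd := hz.sub (hblock i hu)
    have h1 := (hblock i ((continuousAt_gradient isOpen_interior hLipf hint).tendsto.comp hu))
    have h2 := (hblock i ((continuousAt_gradient isOpen_interior hLiph hint).tendsto.comp hu))
    have h3 := (h1.inner hd).add ((((hch.tendsto.comp hr).sub (hch.tendsto.comp hu)).sub
      (h2.inner hd)).const_mul (1 / γ i))
    simpa [blockModel] using h3
  -- The limit's block is a competitor in the proximal step once the replaced point lies in `int dom
  -- h`. This bounds `g i` from above along the sequence, which lower semicontinuity cannot do.
  have hG : ∀ i, ∀ᶠ k in atTop, realPart (g i) (x (k + 1) i) ≤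
      realPart (g i) (xs i) + (blockModel f h γ i (intermediate x k i) (xs i) -
        blockModel f h γ i (intermediate x k i) (x (k + 1) i)) := by
    intro i
    have hr : Tendsto (fun k => replaceBlock (intermediate x k i) i (xs i)) atTop (𝓝 xs) := by
      have := ((continuous_replaceBlock i).tendsto (xs, xs i)).comp
        ((tendsto_intermediate hlim (i : ℕ)).prodMk_nhds tendsto_const_nhds)
      rwa [replaceBlock_self] at this
    filter_upwards [hr.eventually (isOpen_interior.mem_nhds hint)] with k hk
    have := (mem_proxMap hP.h_proper.1 hg (hγ' i) (hx k i)).2.2.2 (xs i) (interior_subset hk)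
      (((mem_dom_objective_iff hP.f_smooth.1.1 hg).1 hxs).2 i)
    linarith
  rw [← tendsto_add_atTop_iff_nat 1]
  have hup : Tendsto (fun k => realPart f (x (k + 1)) + ∑ i, (realPart (g i) (xs i) +
      (blockModel f h γ i (intermediate x k i) (xs i) -
        blockModel f h γ i (intermediate x k i) (x (k + 1) i)))) atTop
      (𝓝 (objectiveReal f g xs)) := by
    have : objectiveReal f g xs =
        realPart f xs + ∑ i, (realPart (g i) (xs i) + (0 - 0)) := by simp [objectiveReal]
    rw [this]
    exact (hcf.tendsto.comp hlim1).add (tendsto_finsetSum _ fun i _ =>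
      ((hmodel i tendsto_const_nhds).sub (hmodel i (hblock i hlim1))).const_add _)
  refine tendsto_of_tendsto_of_tendsto_of_le_of_le' tendsto_const_nhds hup
    (Eventually.of_forall fun k => ?_) ?_
  · have := objective_limit_le hP hσ hγ hx hlim k
    rwa [objective_eq_coe hP.f_smooth.1.1 hg hxs, EReal.coe_le_coe_iff] at this
  · filter_upwards [eventually_all.2 hG] with k hk
    rw [objectiveReal]
    gcongr with i
    exact hk i

/-- Subgradients at the iterates are bounded by the step lengths. -/
lemma exists_subgradient_bound (hP : CompositeProblem f h g L)
    (hLipf : LocallyLipschitzOn (interior (dom h)) (gradient (realPart f)))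
    (hLiph : LocallyLipschitzOn (interior (dom h)) (gradient (realPart h)))
    (hγ : ∀ i, 0 < γ i) (hx : IsSequence f h g γ x)
    (hlim : Tendsto x atTop (𝓝 xs)) (hint : xs ∈ interior (dom h)) :
    ∃ C : ℝ, 0 < C ∧ ∀ᶠ k in atTop, ∃ w ∈ subdifferential (objective f g) (x (k + 1)),
      ‖w‖ ≤ C * ‖x (k + 1) - x k‖ := by
  have hg : ∀ i z, g i z ≠ ⊥ := fun i => (hP.g_proper i).1
  obtain ⟨Kf, tf, htf, hKf⟩ := hLipf hint
  obtain ⟨Kh, th, hth, hKh⟩ := hLiph hint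
  rw [isOpen_interior.nhdsWithin_eq hint] at htf hth
  have hlim1 : Tendsto (fun k => x (k + 1)) atTop (𝓝 xs) := (tendsto_add_atTop_iff_nat 1).2 hlim
  have hsum : 0 ≤ ∑ i, ((Kf : ℝ) + 1 / γ i * Kh) := Finset.sum_nonneg fun i _ => by
    have := hγ i
    positivity
  -- The sum may be zero, for instance when `N = 0`; the `+ 1` keeps the constant positive.
  refine ⟨∑ i, ((Kf : ℝ) + 1 / γ i * Kh) + 1, by linarith, ?_⟩
  have hnear : ∀ m : ℕ, ∀ᶠ k in atTop, intermediate x k m ∈ tf ∩ th := fun m =>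
    (tendsto_intermediate hlim m).eventually (inter_mem htf hth)
  filter_upwards [eventually_all.2 fun i : Fin N => hnear i,
    eventually_all.2 fun i : Fin N => hnear (i + 1),
    hlim1.eventually htf] with k hk1 hk2 hk3
  have hk3 : x (k + 1) ∈ tf := hk3
  -- Block `i` is the subgradient of `g i` supplied by `block_optimality`. Adding `∇f` at the new
  -- iterate leaves only gradient differences.
  set v : BlockSpace n := WithLp.toLp 2 fun i =>
    -gradient (realPart f) (intermediate x k i) i - (1 / γ i) •
      (gradient (realPart h) (intermediate x k (i + 1)) i -
        gradient (realPart h) (intermediate x k i) i) with hv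
  have hxk := iterate_mem_interior hP hγ hx (k + 1)
  have hmem : gradient (realPart f) (x (k + 1)) + v ∈
      regularSubdifferential (objective f g) (x (k + 1)) := by
    refine gradient_add_mem_regularSubdifferential hP.f_smooth.1.1 hg
      (interior_mono hP.f_smooth.2.2.1 hxk) (hP.differentiableAt_f hxk) fun i => ?_
    have hi := intermediate_mem_interior hP hγ hx k (Nat.succ_le_of_lt i.2)
    have e := intermediate_succ x k i
    rw [Nat.succ_eq_add_one, e] at hi
    have := block_optimality hP.h_proper.1 hg (hγ i) (hx k i) hi (hP.differentiableAt_h hi)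
    rw [← e] at this
    exact this
  refine ⟨_, regularSubdifferential_subset _ _ hmem, ?_⟩
  set δ := ‖x (k + 1) - x k‖ with hδ
  have hblk : ∀ i, ‖(gradient (realPart f) (x (k + 1)) + v) i‖ ≤
      ((Kf : ℝ) + 1 / γ i * Kh) * δ := by
    intro i
    have e : (gradient (realPart f) (x (k + 1)) + v) i =
        (gradient (realPart f) (x (k + 1)) - gradient (realPart f) (intermediate x k i)) i -
        (1 / γ i) • (gradient (realPart h) (intermediate x k (i + 1)) -
          gradient (realPart h) (intermediate x k i)) i := by
      simp only [hv, PiLp.add_apply, PiLp.sub_apply]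
      abel
    rw [e]
    have hf1 : ‖gradient (realPart f) (x (k + 1)) - gradient (realPart f) (intermediate x k i)‖
        ≤ Kf * δ :=
      (hKf.norm_sub_le hk3 (hk1 i).1).trans (by gcongr; exact norm_sub_intermediate_le x k i)
    have hh1 : ‖gradient (realPart h) (intermediate x k (i + 1)) -
        gradient (realPart h) (intermediate x k i)‖ ≤ Kh * δ :=
      (hKh.norm_sub_le (hk2 i).2 (hk1 i).2).trans
        (by gcongr; exact norm_intermediate_succ_sub_le x k i)
    have hγi : 0 < 1 / γ i := one_div_pos.2 (hγ i)
    calc _ ≤ _ := norm_sub_le _ _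
      _ ≤ Kf * δ + 1 / γ i * (Kh * δ) := by
          rw [norm_smul, Real.norm_of_nonneg hγi.le]
          gcongr
          · exact (norm_block_le _ i).trans hf1
          · exact (norm_block_le _ i).trans hh1
      _ = _ := by ring
  calc _ ≤ _ := norm_le_sum_norm_block _
    _ ≤ ∑ i, ((Kf : ℝ) + 1 / γ i * Kh) * δ := Finset.sum_le_sum fun i _ => hblk i
    _ = (∑ i, ((Kf : ℝ) + 1 / γ i * Kh)) * δ := (Finset.sum_mul ..).symm
    _ ≤ _ := by gcongr; linarith

/-- The Łojasiewicz inequality in real form. -/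
lemma lojasiewicz_real {E : Type*} [NormedAddCommGroup E] [InnerProductSpace ℝ E]
    {F : E → EReal} {y : E} {θ b : ℝ} (hF : LojasiewiczAt F y θ) (hb : F y = (b : EReal)) :
    ∃ κ ε η : ℝ, 0 < κ ∧ 0 < ε ∧ 0 < η ∧ ∀ u ∈ Metric.ball y ε, ∀ a : ℝ, F u = (a : EReal) →
      b < a → a < b + η → ∀ w ∈ subdifferential F u, (a - b) ^ θ ≤ κ * ‖w‖ := by
  obtain ⟨κ, ε, η, hκ, hε, hη, H⟩ := hF
  refine ⟨κ, ε, η, hκ, hε, hη, fun u hu a ha h1 h2 w hw => ?_⟩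
  have h3 := H u hu (by rw [ha, hb]; exact_mod_cast h1) (by rw [ha, hb]; exact_mod_cast h2)
  have h4 : Metric.infEDist 0 (subdifferential F u) ≤ ENNReal.ofReal ‖w‖ := by
    refine (Metric.infEDist_le_edist_of_mem hw).trans_eq ?_
    rw [edist_dist, dist_zero_left]
  have h5 := h3.trans (mul_le_mul_right h4 _)
  rw [ha, hb, ← EReal.coe_sub, EReal.toReal_coe, ← ENNReal.ofReal_mul hκ.le] at h5
  exact (ENNReal.ofReal_le_ofReal_iff (by positivity)).1 h5

end Convergence

/-! ### Tail estimates and the three regimes -/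

/-- Value decrease and the Łojasiewicz bound along the tail of a convergent BPALM sequence. -/
lemma exists_tail_estimates {N : ℕ} {n : Fin N → ℕ} {f h : BlockSpace n → EReal}
    {g : (i : Fin N) → EuclideanSpace ℝ (Fin (n i)) → EReal} {L σ γ : Fin N → ℝ} {θ : ℝ}
    {x : ℕ → BlockSpace n} {xs : BlockSpace n}
    (hP : CompositeProblem f h g L) (hσ : MultiBlockStronglyConvex h σ)
    (hLipf : LocallyLipschitzOn (interior (dom h)) (gradient (realPart f)))
    (hLiph : LocallyLipschitzOn (interior (dom h)) (gradient (realPart h)))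
    (hγ : ∀ i, 0 < γ i ∧ γ i * L i < 1) (hx : IsSequence f h g γ x)
    (hlim : Tendsto x atTop (𝓝 xs)) (hKL : LojasiewiczAt (objective f g) xs θ) :
    ∃ (S : ℕ → ℝ) (ρ B : ℝ) (K : ℕ), 0 < ρ ∧ 0 < B ∧ ∀ k ≥ K,
      objective f g (x k) - objective f g xs = (S k : EReal) ∧ 0 ≤ S k ∧ S k ≤ 1 ∧
      ρ * ‖x (k + 1) - x k‖ ^ 2 ≤ S k - S (k + 1) ∧
      (0 < S (k + 1) → S (k + 1) ^ θ ≤ B * ‖x (k + 1) - x k‖) := by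
  have hf : ∀ x, f x ≠ ⊥ := hP.f_smooth.1.1
  have hg : ∀ i z, g i z ≠ ⊥ := fun i => (hP.g_proper i).1
  have hγ' : ∀ i, 0 < γ i := fun i => (hγ i).1
  have hxs := limit_mem_dom hP hσ hγ hx hlim
  have hφs := objective_eq_coe hf hg hxs
  obtain ⟨ρ, hρ, hdesc⟩ := sweep_descent hP hσ hγ hx
  obtain ⟨C, hC, hsub⟩ := exists_subgradient_bound hP hLipf hLiph hγ' hx hlim (hP.dom_subset hxs)
  obtain ⟨κ, ε, η, hκ, hε, hη, H⟩ := lojasiewicz_real hKL hφs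
  have hS0 : Tendsto (fun k => objectiveReal f g (x k) - objectiveReal f g xs) atTop (𝓝 0) := by
    simpa using (tendsto_objectiveReal hP hσ hLipf hLiph hγ hx hlim).sub_const
      (objectiveReal f g xs)
  have hev := hsub.and ((((tendsto_add_atTop_iff_nat 1).2 hlim).eventually
    (Metric.ball_mem_nhds xs hε)).and ((hS0.eventually (Iio_mem_nhds one_pos)).and
      (((tendsto_add_atTop_iff_nat 1).2 hS0).eventually (Iio_mem_nhds hη))))
  obtain ⟨K, hK⟩ := eventually_atTop.1 hev
  -- The threshold `K + 1` makes every `x k` in range a successor iterate, so its objective value is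
  -- finite.
  refine ⟨fun k => objectiveReal f g (x k) - objectiveReal f g xs, ρ, κ * C, K + 1, hρ,
    mul_pos hκ hC, fun k hk => ?_⟩
  obtain ⟨⟨w, hw, hwle⟩, hball, h1, h2⟩ := hK k (by omega)
  have h1 : objectiveReal f g (x k) - objectiveReal f g xs < 1 := h1
  have h2 : objectiveReal f g (x (k + 1)) - objectiveReal f g xs < η := h2
  obtain ⟨k, rfl⟩ : ∃ j, k = j + 1 := ⟨k - 1, by omega⟩
  have hφ := objective_eq_coe hf hg (iterate_succ_mem_dom hP hγ' hx k)
  have hle := objective_limit_le hP hσ hγ hx hlim k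
  rw [hφs, EReal.coe_le_coe_iff] at hle
  refine ⟨?_, sub_nonneg.2 hle, h1.le, ?_, fun hpos => ?_⟩
  · rw [hφ, hφs, EReal.coe_sub]
  · exact (hdesc k).trans_eq (sub_sub_sub_cancel_right _ _ _).symm
  · refine (H _ hball _ (objective_eq_coe hf hg (iterate_succ_mem_dom hP hγ' hx (k + 1)))
      (sub_pos.1 hpos) (by linarith) w hw).trans ?_
    rw [mul_assoc]
    gcongr

end BPALM

theorem mainTheorem2 {N : ℕ} {n : Fin N → ℕ}
    (f h : BPALM.BlockSpace n → EReal)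
    (g : (i : Fin N) → EuclideanSpace ℝ (Fin (n i)) → EReal)
    (L σ γ : Fin N → ℝ) (θ : ℝ)
    (x : ℕ → BPALM.BlockSpace n) (xs : BPALM.BlockSpace n)
    (hP : BPALM.CompositeProblem f h g L)
    (hσ : BPALM.MultiBlockStronglyConvex h σ)
    (hLipf : LocallyLipschitzOn (interior (BPALM.dom h)) (gradient (BPALM.realPart f)))
    (hLiph : LocallyLipschitzOn (interior (BPALM.dom h)) (gradient (BPALM.realPart h)))
    (hγ : ∀ i, 0 < γ i ∧ γ i * L i < 1)
    (hx : BPALM.IsSequence f h g γ x)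
    (hlim : Filter.Tendsto x Filter.atTop (nhds xs))
    (hKL : BPALM.LojasiewiczAt (BPALM.objective f g) xs θ) :
    xs ∈ BPALM.dom (BPALM.objective f g) ∧
    (θ = 0 → ∃ K : ℕ, ∀ k ≥ K,
      x k = xs ∧ BPALM.objective f g (x k) = BPALM.objective f g xs) ∧
    (0 < θ → θ ≤ 1 / 2 →
      ∃ lam₁ μ₁ τ τ' : ℝ, 0 < lam₁ ∧ 0 < μ₁ ∧ τ ∈ Set.Ico 0 1 ∧ τ' ∈ Set.Ico 0 1 ∧
        ∃ K : ℕ, ∀ k ≥ K,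
          ‖x k - xs‖ ≤ lam₁ * τ ^ k ∧
          0 ≤ BPALM.objective f g (x k) - BPALM.objective f g xs ∧
          BPALM.objective f g (x k) - BPALM.objective f g xs ≤ ((μ₁ * τ' ^ k : ℝ) : EReal)) ∧
    (1 / 2 < θ → θ < 1 →
      ∃ lam₂ μ₂ : ℝ, 0 < lam₂ ∧ 0 < μ₂ ∧
        ∃ K : ℕ, ∀ k ≥ K + 1,
          ‖x k - xs‖ ≤ lam₂ * (k : ℝ) ^ (-((1 - θ) / (2 * θ - 1))) ∧
          0 ≤ BPALM.objective f g (x k) - BPALM.objective f g xs ∧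
          BPALM.objective f g (x k) - BPALM.objective f g xs ≤
            ((μ₂ * (k : ℝ) ^ (-((1 - θ) / (2 * θ - 1))) : ℝ) : EReal)) := by
  refine ⟨BPALM.limit_mem_dom hP hσ hγ hx hlim, ?_⟩
  obtain ⟨S, ρ, B, K, hρ, hB, H⟩ :=
    BPALM.exists_tail_estimates hP hσ hLipf hLiph hγ hx hlim hKL
  have hdesc : ∀ k ≥ K, ρ * ‖x (k + 1) - x k‖ ^ 2 ≤ S k - S (k + 1) :=
    fun k hk => (H k hk).2.2.2.1
  have hS : ∀ k ≥ K, 0 ≤ S k := fun k hk => (H k hk).2.1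
  -- If the gap vanishes once, descent keeps it zero and forces all later steps to be zero, so every
  -- claim is trivial. Otherwise the Łojasiewicz bound is available at every late index.
  by_cases hfin : ∃ K₀ ≥ K, S K₀ = 0
  · obtain ⟨K₀, hK₀, hS₀⟩ := hfin
    have hzero : ∀ k ≥ K₀, S k = 0 := by
      intro k hk
      induction k, hk using Nat.le_induction with
      | base => exact hS₀
      | succ k hk ih =>
        have h1 := hdesc k (by omega)
        have h2 : 0 ≤ ρ * ‖x (k + 1) - x k‖ ^ 2 := by positivity
        exact le_antisymm (by linarith) (hS _ (by omega))
    have hxk : ∀ k ≥ K₀, x k = xs := by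
      have := BPALM.norm_sub_limit_le_of_telescoping hlim (V := fun _ => 0) (K := K₀)
        (fun _ _ => le_rfl) fun k hk => by
          have h1 := hdesc k (by omega)
          rw [hzero k hk, hzero (k + 1) (by omega), sub_zero] at h1
          have h2 : ‖x (k + 1) - x k‖ ^ 2 ≤ 0 := by
            by_contra! h
            exact absurd h1 (not_le.2 (mul_pos hρ h))
          rw [sub_zero]
          exact (sq_eq_zero_iff.1 (le_antisymm h2 (sq_nonneg _))).le
      exact fun k hk => sub_eq_zero.1 (norm_le_zero_iff.1 (this k hk))
    have hval : ∀ k ≥ K₀, BPALM.objective f g (x k) - BPALM.objective f g xs = 0 := fun k hk => by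
      rw [(H k (by omega)).1, hzero k hk, EReal.coe_zero]
    refine ⟨fun _ => ⟨K₀, fun k hk => ⟨hxk k hk, by rw [hxk k hk]⟩⟩,
      fun _ _ => ⟨1, 1, 0, 0, one_pos, one_pos, ⟨le_rfl, one_pos⟩, ⟨le_rfl, one_pos⟩, K₀,
        fun k hk => ⟨?_, (hval k hk).ge, ?_⟩⟩,
      fun _ _ => ⟨1, 1, one_pos, one_pos, K₀, fun k hk => ⟨?_, (hval k (by omega)).ge, ?_⟩⟩⟩
    · rw [hxk k hk, sub_self, norm_zero]; positivity
    · rw [hval k hk]; exact EReal.coe_nonneg.2 (by positivity)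
    · rw [hxk k (by omega), sub_self, norm_zero]; positivity
    · rw [hval k (by omega)]; exact EReal.coe_nonneg.2 (by positivity)
  · have hpos : ∀ k ≥ K, 0 < S k := fun k hk =>
      (hS k hk).lt_of_ne fun h0 => hfin ⟨k, hk, h0.symm⟩
    have hrate : ∀ k ≥ K, S (k + 1) ^ θ ≤ B * ‖x (k + 1) - x k‖ := fun k hk =>
      (H k hk).2.2.2.2 (hpos (k + 1) (by omega))
    refine ⟨fun hθ => ?_, fun hθ0 hθ => ?_, fun hθ hθ1 => ?_⟩
    -- For `θ = 0` the bound reads `1 ≤ B * ‖x (k + 1) - x k‖`, which contradicts convergence.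
    · exfalso
      have h0 : Tendsto (fun k => B * ‖x (k + 1) - x k‖) atTop (𝓝 0) := by
        simpa using (((tendsto_add_atTop_iff_nat 1).2 hlim).sub hlim).norm.const_mul B
      obtain ⟨k, hk1, hk⟩ := ((h0.eventually (Iio_mem_nhds one_pos)).and
        (eventually_ge_atTop K)).exists
      have := hrate k hk
      rw [hθ, Real.rpow_zero] at this
      exact absurd (Set.mem_Iio.1 hk1) (not_lt.2 this)
    · have hrec : ∀ k ≥ K, S (k + 1) ≤ B ^ 2 / ρ * (S k - S (k + 1)) := fun k hk => by
        have hp := hpos (k + 1) (by omega)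
        -- Since the gap is at most 1 and `2θ ≤ 1`, raising it to the power `2θ` does not decrease
        -- it.
        calc S (k + 1) ≤ (S (k + 1) ^ θ) ^ 2 := by
              rw [← Real.rpow_natCast, ← Real.rpow_mul hp.le]
              conv_lhs => rw [← Real.rpow_one (S (k + 1))]
              exact Real.rpow_le_rpow_of_exponent_ge hp (H (k + 1) (by omega)).2.2.1
                (by push_cast; linarith)
          _ ≤ (B * ‖x (k + 1) - x k‖) ^ 2 := by
              gcongr
              exact hrate k hk
          _ = B ^ 2 / ρ * (ρ * ‖x (k + 1) - x k‖ ^ 2) := by field_simp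
          _ ≤ _ := by
              gcongr
              exact hdesc k hk
      obtain ⟨lam, μ, τ, τ', hlam, hμ, hτ, hτ', hb⟩ :=
        BPALM.linear_rate hlim hρ (by positivity) hS hdesc hrec
      refine ⟨lam, μ, τ, τ', hlam, hμ, hτ, hτ', K, fun k hk => ⟨(hb k hk).1, ?_, ?_⟩⟩
      · rw [(H k hk).1]; exact EReal.coe_nonneg.2 (hS k hk)
      · rw [(H k hk).1]; exact EReal.coe_le_coe_iff.2 (hb k hk).2
    · obtain ⟨lam, μ, hlam, hμ, K', hb⟩ := BPALM.sublinear_rate hlim hρ hB hθ hθ1 hpos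
        (fun k hk => (H k hk).2.2.1) hdesc hrate
      refine ⟨lam, μ, hlam, hμ, max K K', fun k hk => ?_⟩
      have hkK : k ≥ K := by omega
      refine ⟨(hb k (by omega)).1, ?_, ?_⟩
      · rw [(H k hkK).1]; exact EReal.coe_nonneg.2 (hS k hkK)
      · rw [(H k hkK).1]; exact EReal.coe_le_coe_iff.2 (hb k (by omega)).2
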